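/- **Theorem 3.9.** Let $n\ge 0$. Write points of $T^*\mathbb C^n\cong\mathbb C^n\times\mathbb C^n$ as $(z,\zeta)$ with $z=x+iy$, $\zeta=\xi+i\eta$, and set $$\theta_0=\sum_{j=1}^n dx_j\wedge dy_j,\quad \theta_1=\sum_{j=1}^n (dx_j\wedge d\eta_j-dy_j\wedge d\xi_j),\quad \theta_2=\sum_{j=1}^n d\xi_j\wedge d\eta_j,\quad \omega_s=\sum_{j=1}^n (dx_j\wedge d\xi_j+dy_j\wedge d\eta_j),$$ $$\gamma_1=\sum_{j=1}^n (x_jdx_j+y_jdy_j),\quad \gamma_2=\sum_{j=1}^n (x_jdy_j-y_jdx_j),\quad \beta_1=\sum_{j=1}^n (x_jd\xi_j+y_jd\eta_j),\quad \beta_2=\sum_{j=1}^n (x_jd\eta_j-y_jd\xi_j).$$ Let $\omega\in\bigoplus_{k=0}^{2n}(\Omega^{2n-k}(\mathbb C^n)\otimes\Lambda^k\mathbb C^n)^{U(n)}$, that is, let $\omega$ be a smooth real-valued differential form of degree $2n$ on $\mathbb C^n\times\mathbb C^n$ that is invariant under all translations in $\zeta$ and under the diagonal action $(z,\zeta)\mapsto(gz,g\zeta)$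 of $g\in U(n)$. Let $\mathbb R[X,Y,Z,W]_d$ be the space of homogeneous polynomials of degree $d$, which is $\{0\}$ for $d<0$. Then there exist $$R_\alpha\in C^\infty([0,\infty),\mathbb R[X,Y,Z,W]_{n-2}),$$ $$R_{\gamma_1\gamma_2},R_{\gamma_1\beta_1},R_{\gamma_1\beta_2},R_{\gamma_2\beta_1},R_{\gamma_2\beta_2},R_{\beta_1\beta_2}\in C^\infty([0,\infty),\mathbb R[X,Y,Z,W]_{n-1}),$$ $$R_\delta\in C^\infty([0,\infty),\mathbb R[X,Y,Z,W]_n)$$ such that for all $(z,\zeta)\in\mathbb C^n\times\mathbb C^n$ $$\begin{aligned}\omega|_{(z,\zeta)}={}&\gamma_1\wedge\gamma_2\wedge\beta_1\wedge\beta_2\wedge R_\alpha(\theta_0,\theta_1,\theta_2,\omega_s)[|z|^2]\\&+\gamma_1\wedge\gamma_2\wedge R_{\gamma_1\gamma_2}(\theta_0,\theta_1,\theta_2,\omega_s)[|z|^2]+\gamma_1\wedge\beta_1\wedge R_{\gamma_1\beta_1}(\theta_0,\theta_1,\theta_2,\omega_s)[|z|^2]\\&+\gamma_1\wedge\beta_2\wedge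 R_{\gamma_1\beta_2}(\theta_0,\theta_1,\theta_2,\omega_s)[|z|^2]+\gamma_2\wedge\beta_1\wedge R_{\gamma_2\beta_1}(\theta_0,\theta_1,\theta_2,\omega_s)[|z|^2]\\&+\gamma_2\wedge\beta_2\wedge R_{\gamma_2\beta_2}(\theta_0,\theta_1,\theta_2,\omega_s)[|z|^2]+\beta_1\wedge\beta_2\wedge R_{\beta_1\beta_2}(\theta_0,\theta_1,\theta_2,\omega_s)[|z|^2]\\&+R_\delta(\theta_0,\theta_1,\theta_2,\omega_s)[|z|^2].\end{aligned}$$ Here $R(\theta_0,\theta_1,\theta_2,\omega_s)[|z|^2]$ is the polynomial $R(|z|^2)$ evaluated, with the wedge product, at the commuting $2$-forms $\theta_0,\theta_1,\theta_2,\omega_s$. -/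

import Mathlib

noncomputable section

namespace UnitaryForms

/-- The space `ℂⁿ` with its Hermitian norm. -/
abbrev Cn (n : ℕ) : Type := EuclideanSpace ℂ (Fin n)

/-- The cotangent bundle `T*ℂⁿ ≅ ℂⁿ × ℂⁿ`, with points `(z, ζ)`,
`z = x + i y` and `ζ = ξ + i η`. -/
abbrev TCn (n : ℕ) : Type := Cn n × Cn n

/-- The exterior algebra of real-valued alternating forms on `ℂⁿ × ℂⁿ`, that is, the exterior
algebra over `ℝ` of the real dual space. The wedge product is the multiplication `*`. -/
abbrev Forms (n : ℕ) : Type := ExteriorAlgebra ℝ (Module.Dual ℝ (TCn n))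

/-- The `j`-th complex coordinate on `ℂⁿ`, as a real linear map. -/
def coord {n : ℕ} (j : Fin n) : Cn n →ₗ[ℝ] ℂ where
  toFun z := z j
  map_add' _ _ := rfl
  map_smul' _ _ := rfl

/-- The covector `dx_j` on `ℂⁿ × ℂⁿ`. -/
def dx {n : ℕ} (j : Fin n) : Forms n :=
  ExteriorAlgebra.ι ℝ (Complex.reLm ∘ₗ coord j ∘ₗ LinearMap.fst ℝ (Cn n) (Cn n))

/-- The covector `dy_j` on `ℂⁿ × ℂⁿ`. -/
def dy {n : ℕ} (j : Fin n) : Forms n :=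
  ExteriorAlgebra.ι ℝ (Complex.imLm ∘ₗ coord j ∘ₗ LinearMap.fst ℝ (Cn n) (Cn n))

/-- The covector `dξ_j` on `ℂⁿ × ℂⁿ`. -/
def dξ {n : ℕ} (j : Fin n) : Forms n :=
  ExteriorAlgebra.ι ℝ (Complex.reLm ∘ₗ coord j ∘ₗ LinearMap.snd ℝ (Cn n) (Cn n))

/-- The covector `dη_j` on `ℂⁿ × ℂⁿ`. -/
def dη {n : ℕ} (j : Fin n) : Forms n :=
  ExteriorAlgebra.ι ℝ (Complex.imLm ∘ₗ coord j ∘ₗ LinearMap.snd ℝ (Cn n) (Cn n))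

/-- `θ₀ = ∑ dx_j ∧ dy_j`. -/
def θ₀ (n : ℕ) : Forms n := ∑ j, dx j * dy j

/-- `θ₁ = ∑ (dx_j ∧ dη_j - dy_j ∧ dξ_j)`. -/
def θ₁ (n : ℕ) : Forms n := ∑ j, (dx j * dη j - dy j * dξ j)

/-- `θ₂ = ∑ dξ_j ∧ dη_j`. -/
def θ₂ (n : ℕ) : Forms n := ∑ j, dξ j * dη j

/-- The symplectic form `ω_s = ∑ (dx_j ∧ dξ_j + dy_j ∧ dη_j)`. -/
def ωs (n : ℕ) : Forms n := ∑ j, (dx j * dξ j + dy j * dη j)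

/-- `γ₁ = ∑ (x_j dx_j + y_j dy_j)` at a point with first component `z = x + i y`. -/
def γ₁ {n : ℕ} (z : Cn n) : Forms n := ∑ j, ((z j).re • dx j + (z j).im • dy j)

/-- `γ₂ = ∑ (x_j dy_j - y_j dx_j)` at a point with first component `z = x + i y`. -/
def γ₂ {n : ℕ} (z : Cn n) : Forms n := ∑ j, ((z j).re • dy j - (z j).im • dx j)

/-- `β₁ = ∑ (x_j dξ_j + y_j dη_j)` at a point with first component `z = x + i y`. -/
def β₁ {n : ℕ} (z : Cn n) : Forms n := ∑ j, ((z j).re • dξ j + (z j).im • dη j)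

/-- `β₂ = ∑ (x_j dη_j - y_j dξ_j)` at a point with first component `z = x + i y`. -/
def β₂ {n : ℕ} (z : Cn n) : Forms n := ∑ j, ((z j).re • dη j - (z j).im • dξ j)

/-- The diagonal real linear action of a unitary map on `ℂⁿ × ℂⁿ`. -/
def diagonal {n : ℕ} (g : Cn n ≃ₗᵢ[ℂ] Cn n) : TCn n →ₗ[ℝ] TCn n :=
  (g.toLinearEquiv.toLinearMap.restrictScalars ℝ).prodMap
    (g.toLinearEquiv.toLinearMap.restrictScalars ℝ)

/-- The pullback `A^*ω` of a field of forms under a linear map `A`: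
at `p` it is the value `ω (A p)`, with every covector precomposed with `A`. -/
def pullback {n : ℕ} (A : TCn n →ₗ[ℝ] TCn n) (ω : TCn n → Forms n) : TCn n → Forms n :=
  fun p => ExteriorAlgebra.map A.dualMap (ω (A p))

/-- The `U(n)`-invariant elements of `⨁ₖ Ω^{2n-k}(ℂⁿ) ⊗ Λᵏ(ℂⁿ)`, the sum over `0 ≤ k ≤ 2n`, as
differential forms on `ℂⁿ × ℂⁿ`. Since `⨁ₖ Λ^{2n-k}(ℂⁿ)* ⊗ Λᵏ(ℂⁿ)* = Λ^{2n}(ℂⁿ × ℂⁿ)*`, these are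
the smooth differential `2n`-forms that are invariant under translations of `ζ` and under the
diagonal action of `U(n)`. (The action preserves the bidegree, so the whole form is invariant if
and only if its components are.) The forms on `ℂⁿ × ℂⁿ` are a finite dimensional space, in which
smoothness is smoothness of all scalar linear functionals. -/
structure IsInvariantForm {n : ℕ} (ω : TCn n → Forms n) : Prop where
  degree : ∀ p, ω p ∈ ⋀[ℝ]^(2 * n) (Module.Dual ℝ (TCn n))
  smooth : ∀ l : Module.Dual ℝ (Forms n), ContDiff ℝ (⊤ : ℕ∞) fun p => l (ω p)
  translation : ∀ z ζ ζ' : Cn n, ω (z, ζ) = ω (z, ζ')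
  unitary : ∀ g : Cn n ≃ₗᵢ[ℂ] Cn n, pullback (diagonal g) ω = ω

/-- The space `ℝ[X, Y, Z, W]_d` of homogeneous polynomials of degree `d`, where `d` is an integer;
it is zero for `d < 0`. -/
def HomPoly (d : ℤ) : Submodule ℝ (MvPolynomial (Fin 4) ℝ) where
  carrier := {P | ∀ m, P.coeff m ≠ 0 → (m.degree : ℤ) = d}
  zero_mem' := by intro m hm; simp at hm
  add_mem' := by
    intro P Q hP hQ m hm
    by_cases h : P.coeff m = 0
    · exact hQ m (by simpa [h] using hm)
    · exact hP m h
  smul_mem' := by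
    intro c P hP m hm
    exact hP m (fun h => hm (by simp [h]))

/-- `R ∈ C^∞([0, ∞), ℝ[X, Y, Z, W]_d)`: the curve `t ↦ R t`, for `t ∈ [0, ∞)`, takes values in the
finite dimensional space of homogeneous polynomials of degree `d`, and its coefficients are smooth
up to the boundary point `0`. Values at `t < 0` are irrelevant. -/
structure IsSmoothCurve (d : ℤ) (R : ℝ → MvPolynomial (Fin 4) ℝ) : Prop where
  mem : ∀ t ∈ Set.Ici (0 : ℝ), R t ∈ HomPoly d
  smooth : ∀ m : Fin 4 →₀ ℕ, ContDiffOn ℝ (⊤ : ℕ∞) (fun t => (R t).coeff m) (Set.Ici 0)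

/-- The form `P(θ₀, θ₁, θ₂, ω_s)` for `P ∈ ℝ[X, Y, Z, W]`
(written out, since the exterior algebra is not commutative; the four `2`-forms do commute). -/
def evalForms (n : ℕ) (P : MvPolynomial (Fin 4) ℝ) : Forms n :=
  ∑ m ∈ P.support, P.coeff m • (θ₀ n ^ m 0 * θ₁ n ^ m 1 * θ₂ n ^ m 2 * ωs n ^ m 3)

end UnitaryForms

end

/-! An invariant form is determined by its values on one ray `r • e_j`, since `U(n)` is transitive
on spheres and `ζ` does not matter. The origin is fixed by all of `U(n)`; the points of the ray are
fixed by the unitary group of the other coordinates. The proof finds the invariants at these points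
algebraically and then studies how the coefficients depend on `r`.

Algebra. For a set `J` of coordinates, the forms invariant under the unitary group of `ℂᴶ` are
generated by covectors outside `J` and by the invariant 2-forms `symForm`, `skewForm`
(`infInvariant_inf_le`). To see this, put the inner product on forms for which contraction is
adjoint to multiplication. An invariant form orthogonal to those already generated is, by induction
on the degree, killed by the adjoints of the invariant 2-forms. A Casimir identity turns this into a
vanishing sum of squares, so all contractions with vectors of `ℂᴶ` vanish
(`ann_eq_zero_of_annihilated`) and only covectors outside `J` occur. With `J` everything, the value
at the origin is a polynomial in the four 2-forms. With `J` the complement of `j`, the covectors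
left over are `γ₁, γ₂, β₁, β₂` at `e_j`, and even total degree leaves products of zero, two or four
of them.

Analysis. As `-1 ∈ U(n)` and the degree is even, `r ↦ ω (r • e_j)` is even. By Whitney's theorem on
even functions, `ω (ρ • v) - ω 0` is `ρ ^ 2` times a combination of the generators at the unit
vector `v`, with coefficients smooth in `ρ ^ 2` (`exists_smooth_coefficients`). Replacing `v` by `z
= ρ • v` uses up `ρ ^ 2` in the quadratic generators, but `γ₁γ₂β₁β₂` needs `ρ ^ 4`, so its
coefficient must vanish at the origin.

This is `coefficient_zero_eq_zero`. The second derivative of `ω` at the origin is a quadratic form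
in `v` and obeys the parallelogram law, as do all generators except `γ₁γ₂β₁β₂`. The defect of that
one, evaluated on two coordinates, can vanish only if its coefficient does, because polynomials in
the four 2-forms of degree at most the number of unused coordinates are independent
(`eq_zero_of_thetaEval_mul_eq_zero`). -/

section SmoothEvenFunctions

/-! ### Smooth even functions of one variable -/

open Set Filter Topology

/-- The moments `∫₀¹ s ^ k φ (r s) ds` are smooth in `r` when `φ` is. -/
theorem contDiff_moment_comp_mul (n : ℕ) : ∀ (k : ℕ) (φ : ℝ → ℝ), ContDiff ℝ (⊤ : ℕ∞) φ →
    ContDiff ℝ n (fun r : ℝ => ∫ s in (0 : ℝ)..1, s ^ k * φ (r * s)) := by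
  -- Differentiation under the integral raises `k` by one and replaces `φ` by its derivative, hence
  -- the induction over all `k` and `φ` at once.
  have hder : ∀ (k : ℕ) (φ : ℝ → ℝ), ContDiff ℝ (⊤ : ℕ∞) φ → ∀ r : ℝ,
      HasDerivAt (fun r : ℝ => ∫ s in (0 : ℝ)..1, s ^ k * φ (r * s))
        (∫ s in (0 : ℝ)..1, s ^ (k + 1) * deriv φ (r * s)) r := by
    intro k φ hφ r
    have hd : Differentiable ℝ φ := hφ.differentiable (by simp)
    have hc' : Continuous (deriv φ) := hφ.continuous_deriv (by simp)
    have hc : Continuous φ := hφ.continuous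
    obtain ⟨C, hC⟩ := (isCompact_Icc (a := -(|r| + 1)) (b := |r| + 1)).exists_bound_of_continuousOn
      hc'.continuousOn
    refine (intervalIntegral.hasDerivAt_integral_of_dominated_loc_of_deriv_le
      (F := fun r s => s ^ k * φ (r * s)) (F' := fun r s => s ^ (k + 1) * deriv φ (r * s))
      (bound := fun _ => C) (Metric.ball_mem_nhds r one_pos) ?_ ?_ ?_ ?_ ?_ ?_).2
    · exact Eventually.of_forall fun x => (by fun_prop : Continuous _).aestronglyMeasurable
    · exact (by fun_prop : Continuous _).intervalIntegrable _ _
    · exact (by fun_prop : Continuous _).aestronglyMeasurable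
    · refine Eventually.of_forall fun s hs x hx => ?_
      rw [uIoc_of_le zero_le_one] at hs
      have hx' : |x - r| < 1 := by simpa [Real.dist_eq] using hx
      have h1 : |x * s| ≤ |r| + 1 := by
        rw [abs_mul, abs_of_pos hs.1]
        have : |x| ≤ |r| + 1 := by
          have := abs_add_le (x - r) r
          simp only [sub_add_cancel] at this
          linarith
        nlinarith [abs_nonneg x, hs.2, hs.1]
      have h2 := hC (x * s) (abs_le.1 h1)
      have h3 : ‖s ^ (k + 1)‖ ≤ 1 := by
        rw [norm_pow, Real.norm_eq_abs, abs_of_pos hs.1]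
        exact pow_le_one₀ hs.1.le hs.2
      calc ‖s ^ (k + 1) * deriv φ (x * s)‖ = ‖s ^ (k + 1)‖ * ‖deriv φ (x * s)‖ := norm_mul _ _
        _ ≤ 1 * C := mul_le_mul h3 h2 (norm_nonneg _) zero_le_one
        _ = C := one_mul _
    · exact intervalIntegrable_const
    · refine Eventually.of_forall fun s _ x _ => ?_
      have h1 : HasDerivAt (fun x => φ (x * s)) (deriv φ (x * s) * s) x := by
        have := (hd (x * s)).hasDerivAt.comp x ((hasDerivAt_id x).mul_const s)
        simpa [Function.comp_def] using this
      exact (h1.const_mul (s ^ k)).congr_deriv (by ring)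
  induction n with
  | zero =>
    intro k φ hφ
    have : Differentiable ℝ (fun r : ℝ => ∫ s in (0 : ℝ)..1, s ^ k * φ (r * s)) :=
      fun r => (hder k φ hφ r).differentiableAt
    exact contDiff_zero.2 this.continuous
  | succ n ih =>
    intro k φ hφ
    have h : deriv (fun r : ℝ => ∫ s in (0 : ℝ)..1, s ^ k * φ (r * s)) =
        fun r => ∫ s in (0 : ℝ)..1, s ^ (k + 1) * deriv φ (r * s) :=
      funext fun r => (hder k φ hφ r).deriv
    push_cast
    refine contDiff_succ_iff_deriv.2 ⟨fun r => (hder k φ hφ r).differentiableAt, by simp, ?_⟩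
    rw [h]
    exact ih _ _ (ContDiff.deriv' (by simpa using hφ))

/-- Hadamard's lemma on the real line. -/
theorem exists_contDiff_eq_mul_of_zero {f : ℝ → ℝ} (hf : ContDiff ℝ (⊤ : ℕ∞) f) (h0 : f 0 = 0) :
    ∃ g : ℝ → ℝ, ContDiff ℝ (⊤ : ℕ∞) g ∧ ∀ r, f r = r * g r := by
  have hf' : ContDiff ℝ (⊤ : ℕ∞) (deriv f) := ContDiff.deriv' (by simpa using hf)
  refine ⟨fun r => ∫ s in (0 : ℝ)..1, s ^ 0 * deriv f (r * s),
    contDiff_infty.2 fun n => contDiff_moment_comp_mul n 0 _ hf', fun r => ?_⟩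
  simp only [pow_zero, one_mul]
  rw [intervalIntegral.mul_integral_comp_mul_left (f := deriv f)]
  rw [intervalIntegral.integral_deriv_eq_sub (fun x _ => hf.differentiable (by simp) x)
    (hf'.continuous.intervalIntegrable _ _)]
  simp [h0]

/-- Whitney's theorem: a smooth even function is a smooth function of the square. -/
theorem contDiffOn_comp_sqrt_of_even {f : ℝ → ℝ} (hf : ContDiff ℝ (⊤ : ℕ∞) f)
    (he : ∀ r, f (-r) = f r) : ContDiffOn ℝ (⊤ : ℕ∞) (fun t => f (√t)) (Ici 0) := by
  refine contDiffOn_infty.2 fun n => ?_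
  induction n generalizing f with
  | zero =>
    exact contDiffOn_zero.2 (hf.continuous.comp Real.continuous_sqrt).continuousOn
  | succ n ih =>
    have hd : Differentiable ℝ f := hf.differentiable (by simp)
    have hf' : ContDiff ℝ (⊤ : ℕ∞) (deriv f) := ContDiff.deriv' (by simpa using hf)
    have hodd : ∀ r, deriv f (-r) = - deriv f r := by
      intro r
      have h1 := deriv_comp_neg f r
      have h2 : (fun x => f (-x)) = f := funext he
      rw [h2] at h1
      linarith
    -- The derivative of `f (√t)` is `f' (√t) / (2 √t) = g (√t) / 2`, with `g` again smooth and
    -- even, so the induction can continue.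
    obtain ⟨g, hg, hfg⟩ := exists_contDiff_eq_mul_of_zero hf' (by
      have := hodd 0
      simp only [neg_zero] at this
      linarith)
    have hge : ∀ r, g (-r) = g r := by
      intro r
      rcases eq_or_ne r 0 with rfl | hr
      · simp
      · have h1 := hodd r
        rw [hfg, hfg] at h1
        have : r * (g (-r) - g r) = 0 := by linarith
        rcases mul_eq_zero.1 this with h | h
        · exact absurd h hr
        · linarith
    have hpos : ∀ t : ℝ, 0 < t → HasDerivAt (fun t => f (√t)) (g (√t) / 2) t := by
      intro t ht
      have h1 := (hd (√t)).hasDerivAt.comp t (Real.hasDerivAt_sqrt ht.ne')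
      rw [hfg] at h1
      have hs : √t ≠ 0 := (Real.sqrt_pos.2 ht).ne'
      have h2 : √t * g √t * (1 / (2 * √t)) = g (√t) / 2 := by field_simp
      rw [h2] at h1
      exact h1
    have hall : ∀ t ∈ Ici (0 : ℝ),
        HasDerivWithinAt (fun t => f (√t)) (g (√t) / 2) (Ici 0) t := by
      intro t ht
      rcases (mem_Ici.1 ht).eq_or_lt with rfl | ht
      -- The square root is not differentiable at `0`; the one-sided derivative there is the limit
      -- of the derivatives at positive points.
      · refine hasDerivWithinAt_Ici_of_tendsto_deriv (s := Ioi 0)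
          (fun t ht => (hpos t ht).differentiableAt.differentiableWithinAt)
          (hf.continuous.comp Real.continuous_sqrt).continuousWithinAt self_mem_nhdsWithin ?_
        have hcont : Continuous fun t => g (√t) / 2 :=
          (hg.continuous.comp Real.continuous_sqrt).div_const 2
        refine ((hcont.tendsto 0).mono_left nhdsWithin_le_nhds).congr' ?_
        filter_upwards [self_mem_nhdsWithin] with t ht
        exact (hpos t ht).deriv.symm
      · exact (hpos t ht).hasDerivWithinAt
    push_cast
    refine (contDiffOn_succ_iff_derivWithin (uniqueDiffOn_Ici 0)).2
      ⟨fun t ht => (hall t ht).differentiableWithinAt, by simp, ?_⟩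
    refine ((ih hg hge).div_const 2).congr fun t ht => ?_
    exact (hall t ht).derivWithin (uniqueDiffOn_Ici 0 t ht)

/-- A smooth even function vanishing at `0` is `r ^ 2` times a smooth function of `r ^ 2`. -/
theorem exists_contDiffOn_eq_sq_mul_of_even {f : ℝ → ℝ} (hf : ContDiff ℝ (⊤ : ℕ∞) f)
    (he : ∀ r, f (-r) = f r) (h0 : f 0 = 0) :
    ∃ h : ℝ → ℝ, ContDiffOn ℝ (⊤ : ℕ∞) h (Ici 0) ∧ ∀ r, f r = r ^ 2 * h (r ^ 2) := by
  obtain ⟨g, hg, hfg⟩ := exists_contDiff_eq_mul_of_zero hf h0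
  have hodd : ∀ r, r ≠ 0 → g (-r) = - g r := by
    intro r hr
    have h1 := he r
    rw [hfg, hfg] at h1
    have : r * (g (-r) + g r) = 0 := by linarith
    rcases mul_eq_zero.1 this with h | h
    · exact absurd h hr
    · linarith
  -- Oddness of `g` is known only away from `0`; continuity gives the value there.
  have hg0 : g 0 = 0 := by
    have h1 : Tendsto (fun r => g (-r) + g r) (𝓝[≠] 0) (𝓝 (g 0 + g 0)) := by
      have : Continuous fun r => g (-r) + g r := by
        have := hg.continuous
        fun_prop
      simpa using (this.tendsto 0).mono_left nhdsWithin_le_nhds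
    have h2 : Tendsto (fun r => g (-r) + g r) (𝓝[≠] 0) (𝓝 0) := by
      refine tendsto_const_nhds.congr' ?_
      filter_upwards [self_mem_nhdsWithin] with r hr
      rw [hodd r hr]
      ring
    have := tendsto_nhds_unique h1 h2
    linarith
  obtain ⟨k, hk, hgk⟩ := exists_contDiff_eq_mul_of_zero hg hg0
  have hke : ∀ r, k (-r) = k r := by
    intro r
    rcases eq_or_ne r 0 with rfl | hr
    · simp
    · have h1 := hodd r hr
      rw [hgk, hgk] at h1
      have : r * (k (-r) - k r) = 0 := by linarith
      rcases mul_eq_zero.1 this with h | h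
      · exact absurd h hr
      · linarith
  refine ⟨fun t => k (√t), contDiffOn_comp_sqrt_of_even hk hke, fun r => ?_⟩
  simp only [hfg, hgk, Real.sqrt_sq_eq_abs]
  rcases abs_cases r with ⟨h, _⟩ | ⟨h, _⟩ <;> rw [h]
  · ring
  · rw [hke]; ring

end SmoothEvenFunctions

/-! ### Contraction and the inner product on an exterior algebra -/

namespace ExteriorAlgebra

variable {M : Type*} [AddCommGroup M] [Module ℝ M]

local infixl:70 "⌋" => CliffordAlgebra.contractLeft

theorem contractLeft_ι_mul' (d : Module.Dual ℝ M) (m : M) (x : ExteriorAlgebra ℝ M) :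
    d⌋(ι ℝ m * x) = d m • x - ι ℝ m * (d⌋x) :=
  CliffordAlgebra.contractLeft_ι_mul d m x

theorem ι_induction {C : ExteriorAlgebra ℝ M → Prop} (algebraMap : ∀ r, C (algebraMap ℝ _ r))
    (add : ∀ x y, C x → C y → C (x + y)) (ι_mul : ∀ m x, C x → C (ι ℝ m * x)) (x) : C x :=
  CliffordAlgebra.left_induction _ algebraMap add (fun x m h => ι_mul m x h) x

/-- Contraction by all the factors of a product, where covectors act through `φ`. -/
noncomputable def contractHom (φ : M →ₗ[ℝ] Module.Dual ℝ M) :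
    ExteriorAlgebra ℝ M →ₐ[ℝ] Module.End ℝ (ExteriorAlgebra ℝ M) :=
  lift ℝ ⟨CliffordAlgebra.contractLeft ∘ₗ φ, fun m =>
    LinearMap.ext fun x => CliffordAlgebra.contractLeft_contractLeft (φ m) x⟩

theorem contractHom_ι (φ : M →ₗ[ℝ] Module.Dual ℝ M) (m : M) (x : ExteriorAlgebra ℝ M) :
    contractHom φ (ι ℝ m) x = φ m⌋x := by
  simp [contractHom]

/-- The bilinear form on the exterior algebra induced by a bilinear form. -/
noncomputable def inducedForm (φ : M →ₗ[ℝ] Module.Dual ℝ M) :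
    ExteriorAlgebra ℝ M →ₗ[ℝ] ExteriorAlgebra ℝ M →ₗ[ℝ] ℝ :=
  -- The scalar part of the contraction of the second argument by the factors of the first. Reversal
  -- lets the leftmost factor contract first, which makes left multiplication adjoint to
  -- contraction.
  ((contractHom φ).toLinearMap ∘ₗ CliffordAlgebra.reverse).compr₂ algebraMapInv.toLinearMap

theorem inducedForm_ι_mul (φ : M →ₗ[ℝ] Module.Dual ℝ M) (m : M) (x y : ExteriorAlgebra ℝ M) :
    inducedForm φ (ι ℝ m * x) y = inducedForm φ x (φ m⌋y) := by
  simp [inducedForm, CliffordAlgebra.reverse.map_mul, CliffordAlgebra.reverse_ι, contractHom_ι]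

theorem inducedForm_algebraMap (φ : M →ₗ[ℝ] Module.Dual ℝ M) (r : ℝ) (y : ExteriorAlgebra ℝ M) :
    inducedForm φ (algebraMap ℝ _ r) y = r * algebraMapInv y := by
  simp [inducedForm, Algebra.algebraMap_eq_smul_one]

variable {φ : M →ₗ[ℝ] Module.Dual ℝ M} (hφ : ∀ m m', φ m m' = φ m' m)
include hφ

/-- Adjointness in the other argument. Symmetry of `φ` is needed exactly where `m` is moved past a
covector `m'` of `x`. -/
theorem inducedForm_mul_right (m : M) (x y : ExteriorAlgebra ℝ M) :
    inducedForm φ x (ι ℝ m * y) = inducedForm φ (φ m⌋x) y := by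
  induction x using ι_induction generalizing y with
  | algebraMap r =>
    rw [inducedForm_algebraMap, CliffordAlgebra.contractLeft_algebraMap]
    simp [algebraMapInv]
  | add x x' hx hx' => simp [hx, hx']
  | ι_mul m' x hx =>
    rw [inducedForm_ι_mul, contractLeft_ι_mul', contractLeft_ι_mul', map_sub, map_sub, hx,
      LinearMap.sub_apply, inducedForm_ι_mul, map_smul, map_smul, hφ m' m, LinearMap.smul_apply]

theorem inducedForm_comm (x y : ExteriorAlgebra ℝ M) : inducedForm φ x y = inducedForm φ y x := by
  induction x using ι_induction generalizing y with
  | algebraMap r =>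
    rw [inducedForm_algebraMap]
    induction y using ι_induction with
    | algebraMap s =>
      rw [inducedForm_algebraMap]
      simp [algebraMapInv, mul_comm]
    | add x x' hx hx' => simp [← hx, ← hx', mul_add]
    | ι_mul m' x hx =>
      rw [inducedForm_ι_mul, CliffordAlgebra.contractLeft_algebraMap]
      simp [algebraMapInv]
  | add x x' hx hx' => simp [hx, hx']
  | ι_mul m' x hx => rw [inducedForm_ι_mul, inducedForm_mul_right hφ, hx]

omit hφ
section Basis

variable {I : Type*} [DecidableEq I] (b : Module.Basis I ℝ M)

/-- The projection along the basis vectors indexed by `S`. -/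
noncomputable def killProj (S : Finset I) : M →ₗ[ℝ] M :=
  b.constr ℝ fun i => if i ∈ S then 0 else b i

theorem killProj_basis (S : Finset I) (i : I) :
    killProj b S (b i) = if i ∈ S then 0 else b i := by
  simp [killProj]

theorem killProj_singleton (i : I) (m : M) :
    killProj b {i} m = m - b.coord i m • b i := by
  have : killProj b {i} = LinearMap.id - (b.coord i).smulRight (b i) := by
    refine b.ext fun j => ?_
    rw [killProj_basis]
    by_cases h : j = i
    · subst h; simp
    · simp [h]
  rw [this]; simp

/-- Write `x = x₀ + b i ∧ x₁`, where `b i` occurs in neither `x₀` nor `x₁`; both sides return `x₀`.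
-/
theorem map_killProj_singleton (i : I) (x : ExteriorAlgebra ℝ M) :
    map (killProj b {i}) x = x - ι ℝ (b i) * (b.coord i⌋x) := by
  induction x using ι_induction with
  | algebraMap r => simp [CliffordAlgebra.contractLeft_algebraMap]
  | add x y hx hy => rw [map_add, hx, hy, map_add]; noncomm_ring
  | ι_mul m x hx =>
    rw [map_mul, hx, map_apply_ι, killProj_singleton, contractLeft_ι_mul', map_sub, map_smul]
    have h1 : ι ℝ (b i) * (ι ℝ (b i) * (b.coord i⌋x)) = 0 := by
      rw [← mul_assoc, ι_sq_zero, zero_mul]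
    have h2 : ι ℝ (b i) * (ι ℝ m * (b.coord i⌋x)) = - (ι ℝ m * (ι ℝ (b i) * (b.coord i⌋x))) := by
      rw [← mul_assoc, ← mul_assoc, ← neg_mul]
      congr 1
      exact eq_neg_of_add_eq_zero_left (ι_add_mul_swap _ _)
    rw [sub_mul, mul_sub, mul_sub, mul_sub, h2, smul_mul_assoc, smul_mul_assoc, h1,
      mul_smul_comm]
    simp
    abel

/-- Vanishing contractions mean that the basis vectors indexed by `S` do not occur in `x`, so
erasing them changes nothing. -/
theorem map_killProj_of_contract_eq_zero (S : Finset I) (x : ExteriorAlgebra ℝ M)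
    (hx : ∀ i ∈ S, b.coord i⌋x = 0) : map (killProj b S) x = x := by
  induction S using Finset.induction with
  | empty =>
    have : killProj b ∅ = LinearMap.id := b.ext fun j => by simp [killProj_basis]
    rw [this, map_id]; rfl
  | insert i S hi ih =>
    have : killProj b (insert i S) = killProj b {i} ∘ₗ killProj b S := by
      refine b.ext fun j => ?_
      simp only [LinearMap.comp_apply, killProj_basis, Finset.mem_insert]
      by_cases h : j ∈ S
      · simp [h]
      · simp [h, killProj_basis]
    rw [this, ← map_comp_map, AlgHom.comp_apply, ih fun j hj => hx j (Finset.mem_insert_of_mem hj),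
      map_killProj_singleton, hx i (Finset.mem_insert_self i S)]
    simp

theorem eq_algebraMap_of_contract_eq_zero [Fintype I] (x : ExteriorAlgebra ℝ M)
    (hx : ∀ i, b.coord i⌋x = 0) : x = algebraMap ℝ _ (algebraMapInv x) := by
  have h := map_killProj_of_contract_eq_zero b Finset.univ x fun i _ => hx i
  have h0 : killProj b Finset.univ = 0 := b.ext fun j => by simp [killProj_basis]
  rw [h0] at h
  have : ∀ x : ExteriorAlgebra ℝ M, map (0 : M →ₗ[ℝ] M) x = algebraMap ℝ _ (algebraMapInv x) := by
    intro x
    induction x using ι_induction with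
    | algebraMap r => simp [algebraMapInv]
    | add x y hx hy => simp [hx, hy]
    | ι_mul m x hx => simp [algebraMapInv]
  rw [← this, h]

theorem toDual_eq_coord (i : I) : b.toDual (b i) = b.coord i := by
  refine b.ext fun j => ?_
  simp [Module.Basis.toDual_apply, Finsupp.single_apply, eq_comm]

theorem toDual_symm (m m' : M) : b.toDual m m' = b.toDual m' m := by
  have : b.toDual = b.toDual.flip := by
    refine b.ext fun i => b.ext fun j => ?_
    simp [Module.Basis.toDual_apply, eq_comm]
  conv_lhs => rw [this]
  rfl

/-- Induction on the set of basis vectors that may occur in `x`. In `x = x₀ + b i ∧ x₁` the two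
summands are orthogonal and the norm of the second is that of `x₁`; the base case is a scalar, whose
norm is its square. -/
theorem inducedForm_toDual_pos_aux [Fintype I] (S : Finset I) :
    ∀ x : ExteriorAlgebra ℝ M, (∀ i ∉ S, b.coord i⌋x = 0) →
      0 ≤ inducedForm b.toDual x x ∧ (inducedForm b.toDual x x = 0 → x = 0) := by
  induction S using Finset.induction with
  | empty =>
    intro x hx
    have h := eq_algebraMap_of_contract_eq_zero b x fun i => hx i (by simp)
    have h1 : inducedForm b.toDual x x = algebraMapInv x * algebraMapInv x := by
      conv_lhs => rw [h]
      rw [inducedForm_algebraMap]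
      simp [algebraMapInv]
    rw [h1]
    refine ⟨mul_self_nonneg _, fun h0 => ?_⟩
    rw [h, mul_self_eq_zero.1 h0, map_zero]
  | insert i S hi ih =>
    intro x hx
    set x1 := b.coord i⌋x with hx1
    set x0 := x - ι ℝ (b i) * x1 with hx0
    have hxx : x = x0 + ι ℝ (b i) * x1 := by rw [hx0]; abel
    have hii : b.coord i⌋x1 = 0 := CliffordAlgebra.contractLeft_contractLeft _ _
    have hi0 : b.coord i⌋x0 = 0 := by
      rw [hx0, map_sub, contractLeft_ι_mul', hii]
      simp [hx1]
    have hS1 : ∀ j ∉ S, b.coord j⌋x1 = 0 := by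
      intro j hj
      by_cases h : j = i
      · rw [h, hii]
      · rw [hx1, CliffordAlgebra.contractLeft_comm, hx j (by simp [h, hj])]
        simp
    have hS0 : ∀ j ∉ S, b.coord j⌋x0 = 0 := by
      intro j hj
      by_cases h : j = i
      · rw [h, hi0]
      · rw [hx0, map_sub, contractLeft_ι_mul', hS1 j hj, hx j (by simp [h, hj])]
        simp [Ne.symm h]
    have hnorm : inducedForm b.toDual x x =
        inducedForm b.toDual x0 x0 + inducedForm b.toDual x1 x1 := by
      conv_lhs => rw [hxx]
      rw [map_add, map_add, LinearMap.add_apply, LinearMap.add_apply, inducedForm_ι_mul,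
        inducedForm_ι_mul, inducedForm_mul_right (toDual_symm b), toDual_eq_coord,
        contractLeft_ι_mul', hi0, hii]
      simp
    obtain ⟨hp0, hz0⟩ := ih x0 hS0
    obtain ⟨hp1, hz1⟩ := ih x1 hS1
    rw [hnorm]
    refine ⟨add_nonneg hp0 hp1, fun h => ?_⟩
    rw [hxx, hz0 (by linarith), hz1 (by linarith)]
    simp

theorem inducedForm_toDual_nonneg [Fintype I] (x : ExteriorAlgebra ℝ M) :
    0 ≤ inducedForm b.toDual x x :=
  (inducedForm_toDual_pos_aux b Finset.univ x (by simp)).1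

theorem eq_zero_of_inducedForm_toDual_self [Fintype I] {x : ExteriorAlgebra ℝ M}
    (h : inducedForm b.toDual x x = 0) : x = 0 :=
  (inducedForm_toDual_pos_aux b Finset.univ x (by simp)).2 h

/-- Orthogonal decomposition with respect to a subspace of the exterior algebra. -/
theorem exists_sub_orthogonal [Fintype I] (X : Submodule ℝ (ExteriorAlgebra ℝ M))
    [FiniteDimensional ℝ X] (y : ExteriorAlgebra ℝ M) :
    ∃ x ∈ X, ∀ x' ∈ X, inducedForm b.toDual x' (y - x) = 0 := by
  let B : LinearMap.BilinForm ℝ X := (inducedForm b.toDual).domRestrict₁₂ X X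
  -- Positive definiteness passes to every subspace, so the functional given by `y` is represented
  -- by a vector of `X`.
  have hB : LinearMap.BilinForm.Nondegenerate B := by
    refine ⟨fun x hx => ?_, fun x hx => ?_⟩
    · exact Subtype.ext (eq_zero_of_inducedForm_toDual_self b (hx x))
    · exact Subtype.ext (eq_zero_of_inducedForm_toDual_self b (hx x))
  obtain ⟨x, hx⟩ : ∃ x, B x = (inducedForm b.toDual y).domRestrict X :=
    ⟨(B.toDual hB).symm _, LinearEquiv.apply_symm_apply (B.toDual hB) _⟩
  refine ⟨x, x.2, fun x' hx' => ?_⟩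
  have h := LinearMap.congr_fun hx ⟨x', hx'⟩
  have h' : inducedForm b.toDual x x' = inducedForm b.toDual y x' := h
  rw [inducedForm_comm (toDual_symm b), map_sub, LinearMap.sub_apply, h', sub_self]

end Basis

theorem contractLeft_mem_pow (d : Module.Dual ℝ M) (k : ℕ) (x : ExteriorAlgebra ℝ M)
    (hx : x ∈ LinearMap.range (ι ℝ : M →ₗ[ℝ] ExteriorAlgebra ℝ M) ^ (k + 1)) :
    d⌋x ∈ LinearMap.range (ι ℝ : M →ₗ[ℝ] ExteriorAlgebra ℝ M) ^ k := by
  induction k generalizing x with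
  | zero =>
    rw [zero_add, pow_one] at hx
    obtain ⟨m, rfl⟩ := hx
    rw [CliffordAlgebra.contractLeft_ι, pow_zero]
    exact Submodule.algebraMap_mem _
  | succ k ih =>
    rw [pow_succ'] at hx
    induction hx using Submodule.mul_induction_on' with
    | mem_mul_mem m hm y hy =>
      obtain ⟨m, rfl⟩ := hm
      rw [contractLeft_ι_mul']
      refine sub_mem (Submodule.smul_mem _ _ hy) ?_
      rw [pow_succ']
      exact Submodule.mul_mem_mul ⟨m, rfl⟩ (ih y hy)
    | add x _ y _ hx hy => rw [map_add]; exact add_mem hx hy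

end ExteriorAlgebra

noncomputable section

namespace UnitaryForms

open ExteriorAlgebra Finset

variable {n : ℕ}

/-! ### The real structure of `ℂⁿ` and its coordinate subspaces -/

/-- The real part of the Hermitian product, a real bilinear form. -/
def reInner : Cn n →ₗ[ℝ] Cn n →ₗ[ℝ] ℝ :=
  LinearMap.mk₂ ℝ (fun v w => (inner ℂ v w).re)
    (fun u v w => by rw [inner_add_left, Complex.add_re])
    (fun c v w => by
      rw [← Complex.coe_smul, inner_smul_left]
      simp)
    (fun u v w => by rw [inner_add_right, Complex.add_re])
    (fun c v w => by
      rw [← Complex.coe_smul c w, inner_smul_right]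
      simp)

theorem reInner_apply (v w : Cn n) : (reInner v w) = (inner ℂ v w).re := rfl

theorem reInner_comm (v w : Cn n) : (reInner v w) = (reInner w v) := by
  rw [reInner_apply, reInner_apply, ← inner_conj_symm, Complex.conj_re]

theorem reInner_I_left (v w : Cn n) : (reInner (Complex.I • v) w) = (inner ℂ v w).im := by
  rw [reInner_apply, inner_smul_left]
  simp

theorem reInner_I_right (v w : Cn n) : (reInner v (Complex.I • w)) = - (inner ℂ v w).im := by
  rw [reInner_apply, inner_smul_right]
  simp

theorem reInner_I_left_eq (v w : Cn n) : (reInner (Complex.I • v) w) = - (reInner v (Complex.I • w)) := by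
  rw [reInner_I_left, reInner_I_right, neg_neg]

theorem I_smul_I_smul (v : Cn n) : Complex.I • Complex.I • v = - v := by
  rw [smul_smul, Complex.I_mul_I, neg_one_smul]

/-- The vectors `e_j`, `i e_j` of the standard real orthonormal basis of `ℂⁿ`. -/
def realBasis (k : Fin n × Fin 2) : Cn n :=
  (![1, Complex.I] k.2 : ℂ) • EuclideanSpace.single k.1 (1 : ℂ)

theorem realBasis_zero (j : Fin n) : realBasis (j, 0) = EuclideanSpace.single j (1 : ℂ) := by
  simp [realBasis]

theorem realBasis_one (j : Fin n) :
    realBasis (j, 1) = Complex.I • EuclideanSpace.single j (1 : ℂ) := by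
  simp [realBasis]

theorem reInner_single (v : Cn n) (j : Fin n) :
    (reInner v (EuclideanSpace.single j (1 : ℂ))) = (v j).re := by
  rw [reInner_apply, EuclideanSpace.inner_single_right]
  simp

theorem reInner_I_single (v : Cn n) (j : Fin n) :
    (reInner v (Complex.I • EuclideanSpace.single j (1 : ℂ))) = (v j).im := by
  rw [reInner_I_right, EuclideanSpace.inner_single_right]
  simp

/-- The index set of the real basis of the coordinate subspace `ℂᴶ`. -/
abbrev realIndex (J : Finset (Fin n)) : Finset (Fin n × Fin 2) := J ×ˢ univ

theorem sum_realIndex {N : Type*} [AddCommMonoid N] (J : Finset (Fin n)) (f : Cn n → N) :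
    ∑ k ∈ realIndex J, f (realBasis k) =
      ∑ j ∈ J, (f (EuclideanSpace.single j (1 : ℂ)) +
        f (Complex.I • EuclideanSpace.single j (1 : ℂ))) := by
  simp [realIndex, sum_product, Fin.sum_univ_two, realBasis_zero, realBasis_one]

/-- The coordinate subspace `ℂᴶ` of `ℂⁿ`. -/
def coordSubspace (J : Finset (Fin n)) : Submodule ℂ (Cn n) where
  carrier := {v | ∀ j ∉ J, v j = 0}
  zero_mem' := fun j _ => rfl
  add_mem' := fun {v w} hv hw j hj => by simp [hv j hj, hw j hj]
  smul_mem' := fun c v hv j hj => by simp [hv j hj]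

theorem realBasis_mem {J : Finset (Fin n)} {k : Fin n × Fin 2} (hk : k ∈ realIndex J) :
    realBasis k ∈ coordSubspace J := by
  intro j hj
  have : j ≠ k.1 := fun h => hj (h ▸ (mem_product.1 hk).1)
  simp [realBasis, this]

theorem eq_sum_single {J : Finset (Fin n)} {v : Cn n} (hv : v ∈ coordSubspace J) :
    v = ∑ j ∈ J, ((v j).re • EuclideanSpace.single j (1 : ℂ) +
      (v j).im • Complex.I • EuclideanSpace.single j (1 : ℂ)) := by
  ext i
  have h : ∀ j, ((v j).re • EuclideanSpace.single j (1 : ℂ) +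
      (v j).im • Complex.I • EuclideanSpace.single j (1 : ℂ) : Cn n) i =
      if i = j then v j else 0 := by
    intro j
    by_cases h : i = j
    · subst h
      simp
    · simp [h]
  rw [WithLp.ofLp_sum, Finset.sum_apply]
  simp only [h, sum_ite_eq]
  split_ifs with hi
  · rfl
  · exact hv i hi

/-- Expansion of `v` in an orthonormal basis of `ℂᴶ`, pushed through `L`. It collapses most of the
basis sums below. -/
theorem sum_reInner_smul {N : Type*} [AddCommGroup N] [Module ℝ N] {J : Finset (Fin n)} {v : Cn n}
    (hv : v ∈ coordSubspace J) (L : Cn n →ₗ[ℝ] N) :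
    ∑ k ∈ realIndex J, (reInner v (realBasis k)) • L (realBasis k) = L v := by
  rw [sum_realIndex J fun w => (reInner v w) • L w]
  conv_rhs => rw [eq_sum_single hv]
  simp only [map_sum, map_add, map_smul, reInner_single, reInner_I_single]

theorem mem_coordSubspace_univ (v : Cn n) : v ∈ coordSubspace univ := fun j hj =>
  absurd (mem_univ j) hj

/-- Multiplication by `i` permutes the real basis up to sign, and `f` ignores signs. -/
theorem sum_I_smul {N : Type*} [AddCommGroup N] (J : Finset (Fin n)) (f : Cn n → N)
    (hf : ∀ v, f (-v) = f v) :
    ∑ k ∈ realIndex J, f (Complex.I • realBasis k) = ∑ k ∈ realIndex J, f (realBasis k) := by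
  rw [sum_realIndex J f, sum_realIndex J fun v => f (Complex.I • v)]
  refine sum_congr rfl fun j _ => ?_
  rw [I_smul_I_smul, hf, add_comm]

/-- The projections of `ℂⁿ × ℂⁿ` to its two factors. -/
def slot (α : Fin 2) : TCn n →ₗ[ℝ] Cn n :=
  ![LinearMap.fst ℝ (Cn n) (Cn n), LinearMap.snd ℝ (Cn n) (Cn n)] α

/-- The inclusions of the two factors in `ℂⁿ × ℂⁿ`. -/
def inSlot (α : Fin 2) : Cn n →ₗ[ℝ] TCn n :=
  ![LinearMap.inl ℝ (Cn n) (Cn n), LinearMap.inr ℝ (Cn n) (Cn n)] α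

theorem slot_inSlot (α β : Fin 2) (v : Cn n) :
    slot α (inSlot β v) = if α = β then v else 0 := by
  fin_cases α <;> fin_cases β <;> simp [slot, inSlot]

theorem sum_inSlot_slot (p : TCn n) : ∑ α, inSlot α (slot α p) = p := by
  simp [Fin.sum_univ_two, slot, inSlot]

/-- The covector `p ↦ Re ⟨w, p_α⟩`. -/
def cov (α : Fin 2) : Cn n →ₗ[ℝ] Module.Dual ℝ (TCn n) :=
  LinearMap.lcomp ℝ ℝ (slot α) ∘ₗ reInner

theorem cov_apply (α : Fin 2) (w : Cn n) (p : TCn n) : cov α w p = (reInner w (slot α p)) := rfl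

/-- The real basis of the covectors on `ℂⁿ × ℂⁿ`. -/
def covBasis : Module.Basis (Fin 2 × Fin n × Fin 2) ℝ (Module.Dual ℝ (TCn n)) :=
  Module.Basis.ofEquivFun
    { toFun := fun m i => m (inSlot i.1 (realBasis i.2))
      map_add' := fun _ _ => rfl
      map_smul' := fun _ _ => rfl
      invFun := fun c => ∑ i, c i • cov i.1 (realBasis i.2)
      left_inv := fun m => by
        refine LinearMap.ext fun p => ?_
        change (∑ i : Fin 2 × Fin n × Fin 2, m (inSlot i.1 (realBasis i.2)) •
          cov i.1 (realBasis i.2)) p = m p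
        rw [Fintype.sum_prod_type]
        conv_rhs => rw [← sum_inSlot_slot p, map_sum]
        rw [LinearMap.sum_apply]
        refine sum_congr rfl fun α _ => ?_
        have h := sum_reInner_smul (mem_coordSubspace_univ (slot α p)) (m ∘ₗ inSlot α)
        rw [LinearMap.comp_apply] at h
        rw [← h, LinearMap.sum_apply, realIndex, univ_product_univ]
        refine sum_congr rfl fun k _ => ?_
        rw [LinearMap.smul_apply, cov_apply, reInner_comm, smul_eq_mul, smul_eq_mul, mul_comm]
        rfl
      right_inv := fun c => by
        funext i
        obtain ⟨α, j, ε⟩ := i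
        change (∑ i, c i • cov i.1 (realBasis i.2)) (inSlot α (realBasis (j, ε))) = c (α, j, ε)
        have hrb : ∀ j' ε', (reInner (realBasis (j', ε')) (realBasis (j, ε))) =
            if (j', ε') = (j, ε) then 1 else 0 := by
          intro j' ε'
          have h0 := reInner_single (realBasis (j', ε')) j
          have h1 := reInner_I_single (realBasis (j', ε')) j
          by_cases h : j = j'
          · subst h
            fin_cases ε <;> fin_cases ε' <;>
              simp_all [realBasis_zero, realBasis_one]
          · have h' : j' ≠ j := fun e => h e.symm
            fin_cases ε <;> fin_cases ε' <;>
              simp_all [realBasis_zero, realBasis_one]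
        rw [LinearMap.sum_apply, Finset.sum_eq_single (α, j, ε)]
        · simp only [LinearMap.smul_apply, cov_apply, slot_inSlot]
          rw [if_true, hrb]
          simp
        · rintro ⟨α', j', ε'⟩ _ hne
          simp only [LinearMap.smul_apply, cov_apply, slot_inSlot]
          split_ifs with h
          · subst h
            rw [hrb, if_neg (fun h => hne (by rw [h]))]
            simp
          · simp
        · simp }

theorem covBasis_apply (i : Fin 2 × Fin n × Fin 2) : covBasis i = cov i.1 (realBasis i.2) := by
  rw [covBasis, Module.Basis.coe_ofEquivFun]
  simp [Pi.single_apply]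

theorem covBasis_coord (i : Fin 2 × Fin n × Fin 2) :
    covBasis.coord i = Module.Dual.eval ℝ (TCn n) (inSlot i.1 (realBasis i.2)) := by
  refine LinearMap.ext fun m => ?_
  rw [Module.Basis.coord_apply, covBasis, Module.Basis.ofEquivFun_repr_apply]
  rfl

/-- The duality of the basis is the Riesz identification, so the adjoint of multiplication by `cov α
v` is contraction with `v` for every `v`, not only for basis vectors. -/
theorem covBasis_toDual_cov (α : Fin 2) (v : Cn n) :
    covBasis.toDual (cov α v) = Module.Dual.eval ℝ (TCn n) (inSlot α v) := by
  have h1 := sum_reInner_smul (mem_coordSubspace_univ v) (covBasis.toDual ∘ₗ cov α)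
  have h2 := sum_reInner_smul (mem_coordSubspace_univ v)
    (Module.Dual.eval ℝ (TCn n) ∘ₗ inSlot α)
  rw [LinearMap.comp_apply] at h1 h2
  rw [← h1, ← h2]
  refine sum_congr rfl fun k _ => ?_
  rw [LinearMap.comp_apply, LinearMap.comp_apply, ← covBasis_coord (α, k),
    ← covBasis_apply (α, k), toDual_eq_coord]

/-! ### Multiplication, contraction and transfer operators -/

/-- The inner product on forms in which the monomials are orthonormal. -/
abbrev formInner : Forms n →ₗ[ℝ] Forms n →ₗ[ℝ] ℝ := inducedForm covBasis.toDual

/-- Exterior multiplication by the covector `cov α v`. -/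
def cre (α : Fin 2) : Cn n →ₗ[ℝ] Module.End ℝ (Forms n) :=
  LinearMap.mul ℝ (Forms n) ∘ₗ ι ℝ ∘ₗ cov α

/-- Contraction with the vector `v` placed in the factor `α`. -/
def ann (α : Fin 2) : Cn n →ₗ[ℝ] Module.End ℝ (Forms n) :=
  CliffordAlgebra.contractLeft ∘ₗ Module.Dual.eval ℝ (TCn n) ∘ₗ inSlot α

theorem cre_apply (α : Fin 2) (v : Cn n) (x : Forms n) : cre α v x = ι ℝ (cov α v) * x := rfl

theorem ann_ι_mul (α : Fin 2) (v : Cn n) (m : Module.Dual ℝ (TCn n)) (x : Forms n) :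
    ann α v (ι ℝ m * x) = m (inSlot α v) • x - ι ℝ m * ann α v x :=
  contractLeft_ι_mul' _ m x

theorem ann_algebraMap (α : Fin 2) (v : Cn n) (r : ℝ) : ann α v (algebraMap ℝ _ r) = 0 :=
  CliffordAlgebra.contractLeft_algebraMap _ _ _

theorem ann_mul_ann (α β : Fin 2) (v w : Cn n) : ann α v * ann β w = - (ann β w * ann α v) :=
  LinearMap.ext fun _ => CliffordAlgebra.contractLeft_comm _ _ _

theorem end_mul_neg (A B : Module.End ℝ (Forms n)) : A * -B = -(A * B) := mul_neg A B

theorem end_neg_mul (A B : Module.End ℝ (Forms n)) : -A * B = -(A * B) := neg_mul A B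

/-- The canonical anticommutation relations. -/
theorem ann_mul_cre (α β : Fin 2) (v w : Cn n) :
    ann α v * cre β w = (if α = β then (reInner v w) else 0) • 1 - cre β w * ann α v := by
  refine LinearMap.ext fun x => ?_
  simp only [Module.End.mul_apply, LinearMap.sub_apply, LinearMap.smul_apply, Module.End.one_apply,
    cre_apply, ann_ι_mul]
  rw [cov_apply, slot_inSlot]
  congr 2
  by_cases h : α = β
  · simp [h, reInner_comm v w]
  · simp [h, Ne.symm h]

theorem formInner_cre (α : Fin 2) (v : Cn n) (x y : Forms n) :
    formInner (cre α v x) y = formInner x (ann α v y) := by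
  rw [cre_apply, formInner, inducedForm_ι_mul, covBasis_toDual_cov]
  rfl

theorem formInner_comm (x y : Forms n) : formInner x y = formInner y x :=
  inducedForm_comm (toDual_symm _) x y

theorem formInner_ann (α : Fin 2) (v : Cn n) (x y : Forms n) :
    formInner (ann α v x) y = formInner x (cre α v y) := by
  rw [formInner_comm, ← formInner_cre, formInner_comm]

/-- The operator which replaces `w` by `v`, as a derivation of the algebra of forms. -/
def transfer (v w : Cn n) : Module.End ℝ (Forms n) := ∑ α, cre α v * ann α w

theorem transfer_mul_ann (v w u : Cn n) (β : Fin 2) :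
    transfer v w * ann β u = ann β u * transfer v w - (reInner v u) • ann β w := by
  have h : ∀ α, cre α v * ann α w * ann β u =
      ann β u * (cre α v * ann α w) - if α = β then (reInner v u) • ann β w else 0 := by
    intro α
    rw [mul_assoc, ann_mul_ann α β w u, end_mul_neg, ← mul_assoc (ann β u), ann_mul_cre β α u v,
      sub_mul, smul_mul_assoc, one_mul, mul_assoc, reInner_comm u v]
    by_cases h : α = β
    · subst h; simp
    · simp [h, Ne.symm h]
  simp only [transfer, sum_mul, h, mul_sum, sum_sub_distrib]
  simp

theorem formInner_transfer (v w : Cn n) (x y : Forms n) :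
    formInner (transfer v w x) y = formInner x (transfer w v y) := by
  simp only [transfer, LinearMap.sum_apply, map_sum, Module.End.mul_apply]
  refine sum_congr rfl fun α _ => ?_
  rw [formInner_cre, formInner_ann]

theorem transfer_add_left (u v w : Cn n) : transfer (u + v) w = transfer u w + transfer v w := by
  simp [transfer, add_mul, sum_add_distrib]

theorem transfer_add_right (u v w : Cn n) : transfer u (v + w) = transfer u v + transfer u w := by
  simp [transfer, mul_add, sum_add_distrib]

theorem transfer_smul_left (c : ℝ) (v w : Cn n) : transfer (c • v) w = c • transfer v w := by
  simp [transfer]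

theorem transfer_smul_right (c : ℝ) (v w : Cn n) : transfer v (c • w) = c • transfer v w := by
  simp [transfer]

theorem transfer_neg_left (v w : Cn n) : transfer (-v) w = - transfer v w := by
  simp [transfer, end_neg_mul, -neg_add_rev, neg_add]

theorem transfer_neg_right (v w : Cn n) : transfer v (-w) = - transfer v w := by
  simp [transfer, end_mul_neg, -neg_add_rev, neg_add]

/-! ### Invariant 2-forms, their adjoints and infinitesimal invariance -/

/-- The invariant symmetric contraction of two covectors on `ℂᴶ`, as a `2`-form. -/
def symForm (J : Finset (Fin n)) (α β : Fin 2) : Forms n :=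
  ∑ k ∈ realIndex J, ι ℝ (cov α (realBasis k)) * ι ℝ (cov β (realBasis k))

/-- The invariant skew contraction of two covectors on `ℂᴶ`, as a `2`-form. -/
def skewForm (J : Finset (Fin n)) (α β : Fin 2) : Forms n :=
  ∑ k ∈ realIndex J, ι ℝ (cov α (realBasis k)) * ι ℝ (cov β (Complex.I • realBasis k))

/-- The adjoint of multiplication by `symForm J α β`. -/
def symAnn (J : Finset (Fin n)) (α β : Fin 2) : Module.End ℝ (Forms n) :=
  ∑ k ∈ realIndex J, ann β (realBasis k) * ann α (realBasis k)

/-- The adjoint of multiplication by `skewForm J α β`. -/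
def skewAnn (J : Finset (Fin n)) (α β : Fin 2) : Module.End ℝ (Forms n) :=
  ∑ k ∈ realIndex J, ann β (Complex.I • realBasis k) * ann α (realBasis k)

variable (J : Finset (Fin n))

theorem symForm_mul (α β : Fin 2) (x : Forms n) :
    symForm J α β * x = ∑ k ∈ realIndex J, cre α (realBasis k) (cre β (realBasis k) x) := by
  simp only [symForm, sum_mul, cre_apply, mul_assoc]

theorem skewForm_mul (α β : Fin 2) (x : Forms n) :
    skewForm J α β * x =
      ∑ k ∈ realIndex J, cre α (realBasis k) (cre β (Complex.I • realBasis k) x) := by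
  simp only [skewForm, sum_mul, cre_apply, mul_assoc]

theorem formInner_symForm_mul (α β : Fin 2) (x y : Forms n) :
    formInner (symForm J α β * x) y = formInner x (symAnn J α β y) := by
  rw [symForm_mul, symAnn, map_sum, LinearMap.sum_apply, LinearMap.sum_apply, map_sum]
  simp only [Module.End.mul_apply, formInner_cre]

theorem formInner_skewForm_mul (α β : Fin 2) (x y : Forms n) :
    formInner (skewForm J α β * x) y = formInner x (skewAnn J α β y) := by
  rw [skewForm_mul, skewAnn, map_sum, LinearMap.sum_apply, LinearMap.sum_apply, map_sum]
  simp only [Module.End.mul_apply, formInner_cre]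

/-- The forms annihilated by the Lie algebra of the unitary group of `ℂᴶ`. -/
def infInvariant : Submodule ℝ (Forms n) where
  -- The difference of the two sides is the action of the skew-Hermitian operator `v ↦ -i ⟨u, v⟩ u`;
  -- such operators span the Lie algebra over `ℝ`.
  carrier := {x | ∀ u ∈ coordSubspace J,
    transfer u (Complex.I • u) x = transfer (Complex.I • u) u x}
  zero_mem' := fun u _ => by simp
  add_mem' := fun {x y} hx hy u hu => by rw [map_add, map_add, hx u hu, hy u hu]
  smul_mem' := fun c x hx u hu => by rw [map_smul, map_smul, hx u hu]

variable {J}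

/-- Polarization: compare the invariance condition, which is quadratic in `u`, at `v`, `-i w` and `v
- i w`. -/
theorem transfer_add_transfer_I_comm {x : Forms n} (hx : x ∈ infInvariant J) {v w : Cn n}
    (hv : v ∈ coordSubspace J) (hw : w ∈ coordSubspace J) :
    transfer v w x + transfer (Complex.I • v) (Complex.I • w) x =
      transfer w v x + transfer (Complex.I • w) (Complex.I • v) x := by
  have hw' : -(Complex.I • w) ∈ coordSubspace J := neg_mem (Submodule.smul_mem _ _ hw)
  have h1 := hx v hv
  have h2 := hx _ hw'
  have h3 := hx _ (add_mem hv hw')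
  have e : Complex.I • -(Complex.I • w) = w := by rw [smul_neg, I_smul_I_smul, neg_neg]
  simp only [smul_add, e, transfer_add_left, transfer_add_right, transfer_neg_left,
    transfer_neg_right, LinearMap.add_apply, LinearMap.neg_apply] at h1 h2 h3
  have h4 := congrArg₂ (· - ·) h3 (congrArg₂ (· + ·) h1 h2)
  rw [← sub_eq_zero] at h4 ⊢
  rw [← h4]
  abel

theorem transfer_mul_ann_mul_ann (v w k l : Cn n) (α β : Fin 2) :
    transfer v w * (ann β k * ann α l) = ann β k * ann α l * transfer v w
      - (reInner v l) • (ann β k * ann α w) - (reInner v k) • (ann β w * ann α l) := by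
  rw [← mul_assoc, transfer_mul_ann, sub_mul, mul_assoc, transfer_mul_ann, mul_sub, mul_assoc,
    smul_mul_assoc, mul_smul_comm]

theorem transfer_mul_symAnn {v : Cn n} (hv : v ∈ coordSubspace J) (w : Cn n) (α β : Fin 2) :
    transfer v w * symAnn J α β =
      symAnn J α β * transfer v w - ann β v * ann α w - ann β w * ann α v := by
  simp only [symAnn, mul_sum, transfer_mul_ann_mul_ann, sum_sub_distrib, sum_mul]
  have h1 := sum_reInner_smul hv (LinearMap.mulRight ℝ (ann α w) ∘ₗ ann β)
  have h2 := sum_reInner_smul hv (LinearMap.mulLeft ℝ (ann β w) ∘ₗ ann α)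
  simp only [LinearMap.comp_apply, LinearMap.mulRight_apply, LinearMap.mulLeft_apply] at h1 h2
  rw [h1, h2]

theorem transfer_mul_skewAnn {v : Cn n} (hv : v ∈ coordSubspace J) (w : Cn n) (α β : Fin 2) :
    transfer v w * skewAnn J α β = skewAnn J α β * transfer v w
      - ann β (Complex.I • v) * ann α w + ann β w * ann α (Complex.I • v) := by
  simp only [skewAnn, mul_sum, transfer_mul_ann_mul_ann, sum_sub_distrib, sum_mul]
  let mI : Cn n →ₗ[ℝ] Cn n := (LinearMap.lsmul ℂ (Cn n) Complex.I).restrictScalars ℝ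
  have h1 := sum_reInner_smul hv (LinearMap.mulRight ℝ (ann α w) ∘ₗ ann β ∘ₗ mI)
  have h2 := sum_reInner_smul (Submodule.smul_mem _ Complex.I hv)
    (LinearMap.mulLeft ℝ (ann β w) ∘ₗ ann α)
  -- Multiplication by `i` is skew for the real inner product; this is the source of the sign that
  -- distinguishes the skew case from the symmetric one.
  simp only [reInner_I_left_eq, neg_smul, sum_neg_distrib] at h2
  have h1' : ∑ k ∈ realIndex J, (reInner v (realBasis k)) •
      (ann β (Complex.I • realBasis k) * ann α w) = ann β (Complex.I • v) * ann α w := h1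
  have h2' : - ∑ k ∈ realIndex J, (reInner v (Complex.I • realBasis k)) •
      (ann β w * ann α (realBasis k)) = ann β w * ann α (Complex.I • v) := h2
  rw [h1', ← h2', sub_eq_add_neg]

/-- The correction terms in `transfer_mul_symAnn` are unchanged when `u` and `i u` are exchanged, so
they cancel in the difference. -/
theorem symAnn_mem_infInvariant {x : Forms n} (hx : x ∈ infInvariant J) (α β : Fin 2) :
    symAnn J α β x ∈ infInvariant J := by
  intro u hu
  have h1 := LinearMap.congr_fun (transfer_mul_symAnn hu (Complex.I • u) α β) x
  have h2 := LinearMap.congr_fun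
    (transfer_mul_symAnn (Submodule.smul_mem _ Complex.I hu) u α β) x
  simp only [Module.End.mul_apply, LinearMap.sub_apply] at h1 h2
  rw [h1, h2, hx u hu]
  abel

/-- Here the two correction terms in `transfer_mul_skewAnn` cancel each other in each commutator
separately. -/
theorem skewAnn_mem_infInvariant {x : Forms n} (hx : x ∈ infInvariant J) (α β : Fin 2) :
    skewAnn J α β x ∈ infInvariant J := by
  intro u hu
  have h1 := LinearMap.congr_fun (transfer_mul_skewAnn hu (Complex.I • u) α β) x
  have h2 := LinearMap.congr_fun
    (transfer_mul_skewAnn (Submodule.smul_mem _ Complex.I hu) u α β) x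
  simp only [Module.End.mul_apply, LinearMap.sub_apply, LinearMap.add_apply, I_smul_I_smul,
    map_neg, LinearMap.neg_apply] at h1 h2
  rw [h1, h2, hx u hu]
  abel

theorem eq_of_formInner_eq {x y : Forms n} (h : ∀ z, formInner x z = formInner y z) : x = y := by
  rw [← sub_eq_zero]
  refine eq_zero_of_inducedForm_toDual_self covBasis ?_
  rw [LinearMap.map_sub₂]
  exact sub_eq_zero.2 (h _)

/-- Exchanging `u` and `i u` in `transfer` gives the adjoint, so the infinitesimal generators are
skew-adjoint. If they commute with `A`, they commute with its adjoint, multiplication by `θ`. -/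
theorem mul_mem_infInvariant {θ : Forms n} {A : Module.End ℝ (Forms n)}
    (hadj : ∀ x y, formInner (θ * x) y = formInner x (A y))
    (hA : ∀ u ∈ coordSubspace J, ∀ y, transfer (Complex.I • u) u (A y) -
      transfer u (Complex.I • u) (A y) = A (transfer (Complex.I • u) u y) -
      A (transfer u (Complex.I • u) y))
    {x : Forms n} (hx : x ∈ infInvariant J) : θ * x ∈ infInvariant J := by
  intro u hu
  refine eq_of_formInner_eq fun z => ?_
  have h := congrArg (formInner x) (hA u hu z)
  simp only [map_sub, ← hadj, ← formInner_transfer] at h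
  rw [hx u hu, sub_self] at h
  exact sub_eq_zero.1 h.symm

theorem symForm_mul_mem_infInvariant {x : Forms n} (hx : x ∈ infInvariant J) (α β : Fin 2) :
    symForm J α β * x ∈ infInvariant J := by
  refine mul_mem_infInvariant (formInner_symForm_mul J α β) (fun u hu y => ?_) hx
  have h1 := LinearMap.congr_fun (transfer_mul_symAnn hu (Complex.I • u) α β) y
  have h2 := LinearMap.congr_fun
    (transfer_mul_symAnn (Submodule.smul_mem _ Complex.I hu) u α β) y
  simp only [Module.End.mul_apply, LinearMap.sub_apply] at h1 h2
  rw [h1, h2]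
  abel

theorem skewForm_mul_mem_infInvariant {x : Forms n} (hx : x ∈ infInvariant J) (α β : Fin 2) :
    skewForm J α β * x ∈ infInvariant J := by
  refine mul_mem_infInvariant (formInner_skewForm_mul J α β) (fun u hu y => ?_) hx
  have h1 := LinearMap.congr_fun (transfer_mul_skewAnn hu (Complex.I • u) α β) y
  have h2 := LinearMap.congr_fun
    (transfer_mul_skewAnn (Submodule.smul_mem _ Complex.I hu) u α β) y
  simp only [Module.End.mul_apply, LinearMap.sub_apply, LinearMap.add_apply, I_smul_I_smul,
    map_neg, LinearMap.neg_apply] at h1 h2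
  rw [h1, h2]
  abel

/-! ### The Casimir identity and the first fundamental theorem -/

theorem sum_cre_mul_transfer_mul_ann (k l v w : Cn n) :
    ∑ α, ∑ β, cre α k * cre β v * (ann β w * ann α l) =
      transfer k l * transfer v w - (reInner v l) • transfer k w := by
  have h : ∀ α, ∑ β, cre α k * cre β v * (ann β w * ann α l) =
      cre α k * (transfer v w * ann α l) := by
    intro α
    simp only [transfer, sum_mul, mul_sum, mul_assoc]
  simp only [h, transfer_mul_ann, mul_sub, sum_sub_distrib, mul_smul_comm]
  rw [← smul_sum]
  congr 1

variable (J) in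
/-- The Casimir identity. -/
theorem sum_mul_symAnn_add_sum_mul_skewAnn :
    ∑ α, ∑ β, ((∑ k ∈ realIndex J, cre α (realBasis k) * cre β (realBasis k)) * symAnn J α β +
      (∑ k ∈ realIndex J, cre α (realBasis k) * cre β (Complex.I • realBasis k)) *
        skewAnn J α β) =
      ∑ k ∈ realIndex J, ∑ l ∈ realIndex J, transfer (realBasis k) (realBasis l) *
        (transfer (realBasis k) (realBasis l) +
          transfer (Complex.I • realBasis k) (Complex.I • realBasis l)) := by
  have h1 : ∑ α, ∑ β, (∑ k ∈ realIndex J, cre α (realBasis k) * cre β (realBasis k)) *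
      symAnn J α β = ∑ k ∈ realIndex J, ∑ l ∈ realIndex J, ∑ α, ∑ β,
      cre α (realBasis k) * cre β (realBasis k) * (ann β (realBasis l) * ann α (realBasis l)) := by
    simp only [symAnn, sum_mul_sum]
    rw [sum_congr rfl fun α _ => sum_comm, sum_comm]
    refine sum_congr rfl fun k _ => ?_
    rw [sum_congr rfl fun α _ => sum_comm, sum_comm]
  have h2 : ∑ α, ∑ β, (∑ k ∈ realIndex J, cre α (realBasis k) * cre β (Complex.I • realBasis k)) *
      skewAnn J α β = ∑ k ∈ realIndex J, ∑ l ∈ realIndex J, ∑ α, ∑ β,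
      cre α (realBasis k) * cre β (Complex.I • realBasis k) *
        (ann β (Complex.I • realBasis l) * ann α (realBasis l)) := by
    simp only [skewAnn, sum_mul_sum]
    rw [sum_congr rfl fun α _ => sum_comm, sum_comm]
    refine sum_congr rfl fun k _ => ?_
    rw [sum_congr rfl fun α _ => sum_comm, sum_comm]
  simp only [sum_add_distrib]
  rw [h1, h2]
  simp only [sum_cre_mul_transfer_mul_ann, sum_sub_distrib, mul_add, sum_add_distrib]
  -- Reordering into products of transfers leaves first order terms: `transfer k k` from the
  -- symmetric part, its negative from the skew part. They cancel.
  have h3 : ∀ k ∈ realIndex J, ∑ l ∈ realIndex J, (reInner (realBasis k) (realBasis l)) •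
      transfer (realBasis k) (realBasis l) = transfer (realBasis k) (realBasis k) := by
    intro k hk
    exact sum_reInner_smul (realBasis_mem hk) (IsLinearMap.mk' (transfer (realBasis k))
      ⟨transfer_add_right _, fun c v => transfer_smul_right c _ v⟩)
  have h4 : ∀ k ∈ realIndex J, ∑ l ∈ realIndex J,
      (reInner (Complex.I • realBasis k) (realBasis l)) •
      transfer (realBasis k) (Complex.I • realBasis l) = - transfer (realBasis k) (realBasis k) := by
    intro k hk
    have := sum_reInner_smul (Submodule.smul_mem _ Complex.I (realBasis_mem hk))
      (IsLinearMap.mk' (fun v : Cn n => transfer (realBasis k) (Complex.I • v))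
      ⟨fun v w => by rw [smul_add, transfer_add_right],
        fun c v => by rw [smul_comm, transfer_smul_right]⟩)
    simp only [IsLinearMap.mk'_apply, I_smul_I_smul, transfer_neg_right] at this
    exact this
  rw [sum_congr rfl h3, sum_congr rfl h4, sum_neg_distrib]
  abel

/-- The Casimir identity makes the sum of the squared norms of all `G l k` vanish, where `G` is the
complex linear part of `transfer` applied to `y`. The diagonal term `G k k`, paired with `y`, is a
sum of squared norms of contractions. -/
theorem ann_eq_zero_of_annihilated {y : Forms n} (hy : y ∈ infInvariant J)
    (hsym : ∀ α β, symAnn J α β y = 0) (hskew : ∀ α β, skewAnn J α β y = 0)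
    {k : Fin n × Fin 2} (hk : k ∈ realIndex J) (α : Fin 2) : ann α (realBasis k) y = 0 := by
  let G : Cn n → Cn n → Forms n := fun v w =>
    transfer v w y + transfer (Complex.I • v) (Complex.I • w) y
  have hGI : ∀ v w, G (Complex.I • v) (Complex.I • w) = G v w := by
    intro v w
    simp only [G, I_smul_I_smul, transfer_neg_left, transfer_neg_right, neg_neg]
    rw [add_comm]
  -- The Casimir identity at `y`, paired with `y`. Moving one transfer across swaps its arguments,
  -- and `G` is symmetric on `ℂᴶ` by polarization.
  have h0 : ∑ k ∈ realIndex J, ∑ l ∈ realIndex J,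
      formInner (G (realBasis l) (realBasis k)) (transfer (realBasis l) (realBasis k) y) = 0 := by
    have h := LinearMap.congr_fun (sum_mul_symAnn_add_sum_mul_skewAnn J) y
    simp only [LinearMap.sum_apply, LinearMap.add_apply, Module.End.mul_apply, hsym, hskew,
      map_zero, add_zero, sum_const_zero] at h
    have h' := congrArg (fun z => formInner z y) h.symm
    simp only [map_sum, LinearMap.sum_apply, map_zero, LinearMap.zero_apply,
      formInner_transfer] at h'
    rw [← h']
    refine sum_congr rfl fun k hk => sum_congr rfl fun l hl => ?_
    rw [transfer_add_transfer_I_comm hy (realBasis_mem hk) (realBasis_mem hl)]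
  -- The same sum, reindexed by multiplying both basis vectors by `i`, under which `G` is invariant.
  -- Adding it to `h0` completes `G` in the second argument.
  have h1 : ∑ k ∈ realIndex J, ∑ l ∈ realIndex J,
      formInner (G (realBasis l) (realBasis k))
        (transfer (Complex.I • realBasis l) (Complex.I • realBasis k) y) = 0 := by
    rw [← h0]
    have hF : ∀ v w, formInner (G (Complex.I • v) (Complex.I • w))
        (transfer (Complex.I • v) (Complex.I • w) y) =
        formInner (G v w) (transfer (Complex.I • v) (Complex.I • w) y) := by
      intro v w
      rw [hGI]
    have hneg1 : ∀ v w, formInner (G (-v) w) (transfer (-v) w y) =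
        formInner (G v w) (transfer v w y) := by
      intro v w
      simp only [G, smul_neg, transfer_neg_left, LinearMap.neg_apply, ← neg_add, map_neg, neg_neg]
    have hneg2 : ∀ v w, formInner (G v (-w)) (transfer v (-w) y) =
        formInner (G v w) (transfer v w y) := by
      intro v w
      simp only [G, smul_neg, transfer_neg_right, LinearMap.neg_apply, ← neg_add, map_neg, neg_neg]
    simp only [← hF]
    rw [sum_congr rfl fun k _ => sum_I_smul J (fun v => formInner (G v (Complex.I • realBasis k))
      (transfer v (Complex.I • realBasis k) y)) fun v => hneg1 _ _]
    rw [sum_comm]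
    conv_rhs => rw [sum_comm]
    exact sum_congr rfl fun l _ => sum_I_smul J (fun v => formInner (G (realBasis l) v)
      (transfer (realBasis l) v y)) fun v => hneg2 _ _
  have h2 : ∑ k ∈ realIndex J, ∑ l ∈ realIndex J,
      formInner (G (realBasis l) (realBasis k)) (G (realBasis l) (realBasis k)) = 0 := by
    have := congrArg₂ (· + ·) h0 h1
    simp only [← sum_add_distrib, ← map_add, add_zero] at this
    exact this
  have h3 : G (realBasis k) (realBasis k) = 0 := by
    have h4 := (sum_eq_zero_iff_of_nonneg fun k _ => sum_nonneg fun l _ =>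
      inducedForm_toDual_nonneg covBasis _).1 h2 k hk
    exact eq_zero_of_inducedForm_toDual_self covBasis
      ((sum_eq_zero_iff_of_nonneg fun l _ => inducedForm_toDual_nonneg covBasis _).1 h4 k hk)
  have h5 : ∑ α, (formInner (ann α (realBasis k) y) (ann α (realBasis k) y) +
      formInner (ann α (Complex.I • realBasis k) y) (ann α (Complex.I • realBasis k) y)) = 0 := by
    have := congrArg (fun z => formInner z y) h3
    simpa only [G, transfer, LinearMap.sum_apply, Module.End.mul_apply, ← sum_add_distrib, map_sum,
      map_add, LinearMap.add_apply, formInner_cre, map_zero, LinearMap.zero_apply] using this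
  have h6 := (sum_eq_zero_iff_of_nonneg fun α _ => add_nonneg
    (inducedForm_toDual_nonneg covBasis (ann α (realBasis k) y))
    (inducedForm_toDual_nonneg covBasis (ann α (Complex.I • realBasis k) y))).1 h5 α (mem_univ α)
  refine eq_zero_of_inducedForm_toDual_self covBasis (le_antisymm ?_
    (inducedForm_toDual_nonneg covBasis _))
  have h7 := inducedForm_toDual_nonneg covBasis (ann α (Complex.I • realBasis k) y)
  linarith

variable (J) in
/-- The span of the covectors on the complementary coordinates. -/
def outerSpan : Submodule ℝ (Forms n) :=
  Submodule.span ℝ {x | ∃ (α : Fin 2) (j : Fin n) (ε : Fin 2),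
    j ∉ J ∧ x = ι ℝ (cov α (realBasis (j, ε)))}

/-- The projection erasing the covectors of `ℂᴶ` fixes `y` and sends every covector into `outerSpan
J`. -/
theorem mem_outerSpan_pow {y : Forms n} {d : ℕ}
    (hd : y ∈ LinearMap.range (ι ℝ : Module.Dual ℝ (TCn n) →ₗ[ℝ] Forms n) ^ d)
    (hy : ∀ k ∈ realIndex J, ∀ α, ann α (realBasis k) y = 0) : y ∈ outerSpan J ^ d := by
  let S : Finset (Fin 2 × Fin n × Fin 2) := univ ×ˢ realIndex J
  have h := map_killProj_of_contract_eq_zero covBasis S y fun i hi => by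
    rw [covBasis_coord]
    exact hy i.2 (mem_product.1 hi).2 i.1
  have h1 : (LinearMap.range (ι ℝ : Module.Dual ℝ (TCn n) →ₗ[ℝ] Forms n)).map
      (map (killProj covBasis S)).toLinearMap ≤ outerSpan J := by
    rintro _ ⟨_, ⟨m, rfl⟩, rfl⟩
    rw [AlgHom.toLinearMap_apply, map_apply_ι]
    rw [← covBasis.sum_repr m, map_sum, map_sum]
    refine sum_mem fun i _ => ?_
    rw [map_smul, map_smul, killProj_basis]
    refine Submodule.smul_mem _ _ ?_
    split_ifs with hi
    · simp
    · refine Submodule.subset_span ⟨i.1, i.2.1, i.2.2, fun hJ => hi ?_, ?_⟩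
      · simp [S, hJ]
      · rw [covBasis_apply]
  have h2 := Submodule.mem_map_of_mem (f := (map (killProj covBasis S)).toLinearMap) hd
  rw [Submodule.map_pow, AlgHom.toLinearMap_apply, h] at h2
  exact pow_le_pow_left' h1 d h2

instance : FiniteDimensional ℝ (Forms n) :=
  Module.Finite.of_basis
    ((covBasis (n := n)).reindex (Fintype.equivFin (Fin 2 × Fin n × Fin 2))).ExteriorAlgebra

/-- The first fundamental theorem for the unitary group of `ℂᴶ` acting on forms. -/
theorem infInvariant_inf_le {X : ℕ → Submodule ℝ (Forms n)} (hout : ∀ d, outerSpan J ^ d ≤ X d)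
    (hsym : ∀ d α β, ∀ x ∈ X d, symForm J α β * x ∈ X (d + 2))
    (hskew : ∀ d α β, ∀ x ∈ X d, skewForm J α β * x ∈ X (d + 2)) (d : ℕ) :
    infInvariant J ⊓ LinearMap.range (ι ℝ : Module.Dual ℝ (TCn n) →ₗ[ℝ] Forms n) ^ d ≤ X d := by
  have hpow : ∀ (v w : Cn n) (α β : Fin 2) (d : ℕ), ∀ x ∈
      LinearMap.range (ι ℝ : Module.Dual ℝ (TCn n) →ₗ[ℝ] Forms n) ^ (d + 2),
      (ann β v * ann α w) x ∈
        LinearMap.range (ι ℝ : Module.Dual ℝ (TCn n) →ₗ[ℝ] Forms n) ^ d :=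
    fun v w α β d x hx => contractLeft_mem_pow _ _ _ (contractLeft_mem_pow _ _ _ hx)
  have hlow : ∀ d < 2, ∀ (v w : Cn n) (α β : Fin 2), ∀ x ∈
      LinearMap.range (ι ℝ : Module.Dual ℝ (TCn n) →ₗ[ℝ] Forms n) ^ d,
      (ann β v * ann α w) x = 0 := by
    intro d hd v w α β x hx
    interval_cases d
    · rw [pow_zero, Submodule.mem_one] at hx
      obtain ⟨r, rfl⟩ := hx
      rw [Module.End.mul_apply, ann_algebraMap, map_zero]
    · rw [pow_one] at hx
      obtain ⟨m, rfl⟩ := hx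
      rw [Module.End.mul_apply]
      have : ann α w (ι ℝ m) = algebraMap ℝ _ (m (inSlot α w)) :=
        CliffordAlgebra.contractLeft_ι _ _ _
      rw [this, ann_algebraMap]
  induction d using Nat.strong_induction_on with
  | _ d ih =>
    rintro y ⟨hyI, hyd⟩
    -- Projecting onto this intersection rather than onto `X d` keeps the remainder `z` invariant
    -- and homogeneous.
    set Y := X d ⊓ (infInvariant J ⊓
      LinearMap.range (ι ℝ : Module.Dual ℝ (TCn n) →ₗ[ℝ] Forms n) ^ d) with hY
    obtain ⟨x, hx, hort⟩ := exists_sub_orthogonal covBasis Y y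
    have hzI : y - x ∈ infInvariant J := sub_mem hyI hx.2.1
    have hzd := sub_mem hyd hx.2.2
    set z := y - x with hz
    -- By induction `A z` lies in `X` two degrees lower, so `θ * A z` lies in `Y`. Orthogonality
    -- then says that the squared norm of `A z`, which equals `⟨θ * A z, z⟩`, is zero.
    have key : ∀ (θ : Forms n) (A : Module.End ℝ (Forms n)),
        (∀ x y, formInner (θ * x) y = formInner x (A y)) →
        (∀ x ∈ infInvariant J, A x ∈ infInvariant J) →
        (∀ x ∈ infInvariant J, θ * x ∈ infInvariant J) →
        (∀ d, ∀ x ∈ X d, θ * x ∈ X (d + 2)) →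
        (∀ d, ∀ x ∈ LinearMap.range (ι ℝ : Module.Dual ℝ (TCn n) →ₗ[ℝ] Forms n) ^ d,
          θ * x ∈ LinearMap.range (ι ℝ : Module.Dual ℝ (TCn n) →ₗ[ℝ] Forms n) ^ (d + 2)) →
        (∀ d, ∀ x ∈ LinearMap.range (ι ℝ : Module.Dual ℝ (TCn n) →ₗ[ℝ] Forms n) ^ (d + 2),
          A x ∈ LinearMap.range (ι ℝ : Module.Dual ℝ (TCn n) →ₗ[ℝ] Forms n) ^ d) →
        (∀ d < 2, ∀ x ∈ LinearMap.range (ι ℝ : Module.Dual ℝ (TCn n) →ₗ[ℝ] Forms n) ^ d,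
          A x = 0) → A z = 0 := by
      intro θ A hadj hAI hθI hθX hθd hAd hA0
      rcases lt_or_ge d 2 with h2 | h2
      · exact hA0 d h2 z hzd
      · obtain ⟨e, rfl⟩ := Nat.exists_eq_add_of_le' h2
        have h3 := ih e (by omega) ⟨hAI z hzI, hAd e z hzd⟩
        have h4 := hort (θ * A z) ⟨hθX e _ h3, hθI _ (hAI z hzI), hθd e _ (hAd e z hzd)⟩
        rw [hadj] at h4
        exact eq_zero_of_inducedForm_toDual_self covBasis h4
    have hmul : ∀ (v w : Cn n) (α β : Fin 2) (d : ℕ), ∀ x ∈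
        LinearMap.range (ι ℝ : Module.Dual ℝ (TCn n) →ₗ[ℝ] Forms n) ^ d,
        ι ℝ (cov α v) * ι ℝ (cov β w) * x ∈
          LinearMap.range (ι ℝ : Module.Dual ℝ (TCn n) →ₗ[ℝ] Forms n) ^ (d + 2) := by
      intro v w α β d x hx
      rw [add_comm, pow_add, pow_two]
      exact Submodule.mul_mem_mul (Submodule.mul_mem_mul ⟨_, rfl⟩ ⟨_, rfl⟩) hx
    have hs : ∀ α β, symAnn J α β z = 0 := fun α β => by
      refine key (symForm J α β) _ (formInner_symForm_mul J α β)
        (fun x hx => symAnn_mem_infInvariant hx α β)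
        (fun x hx => symForm_mul_mem_infInvariant hx α β) (fun d => hsym d α β)
        (fun d x hx => ?_) (fun d x hx => ?_) (fun d hd x hx => ?_)
      · rw [symForm, sum_mul]
        exact sum_mem fun k _ => hmul _ _ _ _ _ _ hx
      · rw [symAnn, LinearMap.sum_apply]
        exact sum_mem fun k _ => hpow _ _ _ _ _ _ hx
      · rw [symAnn, LinearMap.sum_apply]
        exact sum_eq_zero fun k _ => hlow d hd _ _ _ _ _ hx
    have hk : ∀ α β, skewAnn J α β z = 0 := fun α β => by
      refine key (skewForm J α β) _ (formInner_skewForm_mul J α β)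
        (fun x hx => skewAnn_mem_infInvariant hx α β)
        (fun x hx => skewForm_mul_mem_infInvariant hx α β) (fun d => hskew d α β)
        (fun d x hx => ?_) (fun d x hx => ?_) (fun d hd x hx => ?_)
      · rw [skewForm, sum_mul]
        exact sum_mem fun k _ => hmul _ _ _ _ _ _ hx
      · rw [skewAnn, LinearMap.sum_apply]
        exact sum_mem fun k _ => hpow _ _ _ _ _ _ hx
      · rw [skewAnn, LinearMap.sum_apply]
        exact sum_eq_zero fun k _ => hlow d hd _ _ _ _ _ hx
    have hzX : z ∈ X d := hout d (mem_outerSpan_pow hzd fun k hkJ α =>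
      ann_eq_zero_of_annihilated hzI hs hk hkJ α)
    have hyx : y = x + z := by rw [hz]; abel
    rw [hyx]
    exact add_mem hx.1 hzX

/-! ### From invariance under the group to its Lie algebra -/

theorem hasDerivAt_map_rotation {M : Type*} [AddCommGroup M] [Module ℝ M] {N₁ N₂ : M →ₗ[ℝ] M}
    {D : ExteriorAlgebra ℝ M →ₗ[ℝ] ExteriorAlgebra ℝ M}
    (hD0 : ∀ r, D (algebraMap ℝ _ r) = 0)
    (hD : ∀ m x, D (ι ℝ m * x) = ι ℝ (N₂ m) * x + ι ℝ m * D x) (x : ExteriorAlgebra ℝ M)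
    (l : ExteriorAlgebra ℝ M →ₗ[ℝ] ℝ) :
    HasDerivAt (fun t : ℝ => l (map (LinearMap.id + (Real.cos t - 1) • N₁ + Real.sin t • N₂) x))
      (l (D x)) 0 := by
  induction x using ι_induction generalizing l with
  | algebraMap r =>
    simp only [AlgHom.commutes, hD0, map_zero]
    exact hasDerivAt_const _ _
  | add x y hx hy =>
    simp only [map_add]
    exact (hx l).add (hy l)
  | ι_mul m x hx =>
    have h (m : M) := hx (l ∘ₗ LinearMap.mulLeft ℝ (ι ℝ m))
    simp only [LinearMap.comp_apply, LinearMap.mulLeft_apply] at h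
    have hcos : HasDerivAt (fun t : ℝ => Real.cos t - 1) 0 0 := by
      simpa using (Real.hasDerivAt_cos 0).sub_const 1
    have hsin : HasDerivAt Real.sin 1 0 := by simpa using Real.hasDerivAt_sin 0
    -- Product rule at `t = 0`: `cos` has derivative zero there, so `N₁` drops out and `N₂` extends
    -- as a derivation.
    have h1 := ((h m).add (hcos.mul (h (N₁ m)))).add (hsin.mul (h (N₂ m)))
    refine (h1.congr_deriv ?_).congr_of_eventuallyEq (Filter.Eventually.of_forall fun t => ?_)
    · simp [hD, map_id]
      ring
    · simp only [map_mul, map_apply_ι, LinearMap.add_apply, LinearMap.smul_apply,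
        LinearMap.id_apply, map_add, map_smul, add_mul, smul_mul_assoc, smul_eq_mul, Pi.add_apply,
        Pi.mul_apply]

theorem eq_zero_of_map_rotation_eq {M : Type*} [AddCommGroup M] [Module ℝ M] {N₁ N₂ : M →ₗ[ℝ] M}
    {D : ExteriorAlgebra ℝ M →ₗ[ℝ] ExteriorAlgebra ℝ M}
    (hD0 : ∀ r, D (algebraMap ℝ _ r) = 0)
    (hD : ∀ m x, D (ι ℝ m * x) = ι ℝ (N₂ m) * x + ι ℝ m * D x) {x : ExteriorAlgebra ℝ M}
    (hx : ∀ t : ℝ, map (LinearMap.id + (Real.cos t - 1) • N₁ + Real.sin t • N₂) x = x) :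
    D x = 0 := by
  refine (Module.forall_dual_apply_eq_zero_iff ℝ _).1 fun l => ?_
  have h := hasDerivAt_map_rotation (N₁ := N₁) hD0 hD x l
  simp only [hx] at h
  exact h.unique (hasDerivAt_const _ _)

theorem transfer_algebraMap (v w : Cn n) (r : ℝ) : transfer v w (algebraMap ℝ _ r) = 0 := by
  simp [transfer, ann_algebraMap]

theorem transfer_ι_mul (v w : Cn n) (m : Module.Dual ℝ (TCn n)) (x : Forms n) :
    transfer v w (ι ℝ m * x) =
      ι ℝ (∑ α, m (inSlot α w) • cov α v) * x + ι ℝ m * transfer v w x := by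
  simp only [transfer, LinearMap.sum_apply, Module.End.mul_apply, ann_ι_mul, map_sub, map_smul,
    cre_apply, map_sum, sum_mul, mul_sum, ← sum_add_distrib, smul_mul_assoc]
  refine sum_congr rfl fun α _ => ?_
  rw [← mul_assoc, ← mul_assoc, eq_neg_of_add_eq_zero_left (ι_add_mul_swap (cov α v) m)]
  noncomm_ring

/-- The complex reflection `v ↦ v + (c - 1) ⟨u, v⟩ u`. -/
def complexReflection (u : Cn n) (hu : ‖u‖ = 1) (c : ℂ) (hc : starRingEnd ℂ c * c = 1) :
    Cn n ≃ₗᵢ[ℂ] Cn n :=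
  LinearIsometry.toLinearIsometryEquiv
    ((LinearMap.id + (c - 1) • (innerₛₗ ℂ u).smulRight u).isometryOfInner fun v w => by
      have huu : inner ℂ u u = (1 : ℂ) := by
        rw [inner_self_eq_norm_sq_to_K, hu]; simp
      simp only [LinearMap.add_apply, LinearMap.id_apply, LinearMap.smul_apply,
        LinearMap.smulRight_apply, innerₛₗ_apply_apply, inner_add_left, inner_add_right,
        inner_smul_left, inner_smul_right, huu, map_sub, map_one, inner_conj_symm]
      linear_combination (inner ℂ v u * inner ℂ u w) * hc) rfl

theorem complexReflection_apply (u : Cn n) (hu : ‖u‖ = 1) (c : ℂ)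
    (hc : starRingEnd ℂ c * c = 1) (v : Cn n) :
    complexReflection u hu c hc v = v + (c - 1) • (inner ℂ u v : ℂ) • u := by
  simp [complexReflection]

theorem diagonal_apply (g : Cn n ≃ₗᵢ[ℂ] Cn n) (p : TCn n) : diagonal g p = (g p.1, g p.2) := rfl

theorem slot_diagonal (g : Cn n ≃ₗᵢ[ℂ] Cn n) (α : Fin 2) (p : TCn n) :
    slot α (diagonal g p) = g (slot α p) := by
  fin_cases α <;> rfl

/-- Invariance under the unitary group of `ℂᴶ` implies invariance under its Lie algebra. -/
theorem mem_infInvariant_of_map_eq {J : Finset (Fin n)} {x : Forms n}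
    (h : ∀ g : Cn n ≃ₗᵢ[ℂ] Cn n, (∀ v, (∀ u ∈ coordSubspace J, inner ℂ u v = 0) → g v = v) →
      ExteriorAlgebra.map (diagonal g).dualMap x = x) : x ∈ infInvariant J := by
  have hunit : ∀ u ∈ coordSubspace J, ‖u‖ = 1 →
      transfer u (Complex.I • u) x = transfer (Complex.I • u) u x := by
    intro u huJ hu
    -- Pullback along the reflection with `c = exp (i t)` is `id + (cos t - 1) N₁ + sin t N₂`: `N₁`
    -- projects onto the complex line of `u`, and `N₂` generates the rotation in it.
    let N₁ : Module.Dual ℝ (TCn n) →ₗ[ℝ] Module.Dual ℝ (TCn n) :=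
      ∑ α, ((Module.Dual.eval ℝ (TCn n) (inSlot α u)).smulRight (cov α u) +
        (Module.Dual.eval ℝ (TCn n) (inSlot α (Complex.I • u))).smulRight
          (cov α (Complex.I • u)))
    let N₂ : Module.Dual ℝ (TCn n) →ₗ[ℝ] Module.Dual ℝ (TCn n) :=
      ∑ α, ((Module.Dual.eval ℝ (TCn n) (inSlot α (Complex.I • u))).smulRight (cov α u) -
        (Module.Dual.eval ℝ (TCn n) (inSlot α u)).smulRight (cov α (Complex.I • u)))
    have hN₂ : ∀ m, N₂ m = ∑ α, m (inSlot α (Complex.I • u)) • cov α u -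
        ∑ α, m (inSlot α u) • cov α (Complex.I • u) := by
      intro m
      simp [N₂]
      abel
    have hkey := eq_zero_of_map_rotation_eq (N₁ := N₁) (N₂ := N₂) (x := x)
      (D := transfer u (Complex.I • u) - transfer (Complex.I • u) u)
      (fun r => by simp [transfer_algebraMap])
      (fun m y => by
        simp only [LinearMap.sub_apply, transfer_ι_mul, hN₂, map_sub, sub_mul, mul_sub]
        abel)
      (fun t => ?_)
    · rw [LinearMap.sub_apply] at hkey
      exact sub_eq_zero.1 hkey
    · have hc : starRingEnd ℂ (Complex.exp (t * Complex.I)) * Complex.exp (t * Complex.I) = 1 := by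
        rw [← Complex.exp_conj, ← Complex.exp_add]
        simp
      have hg := h (complexReflection u hu _ hc) fun v hv => by
        rw [complexReflection_apply, hv u huJ]
        simp
      convert hg using 2
      congr 1
      refine LinearMap.ext fun m => LinearMap.ext fun p => ?_
      have hp : diagonal (complexReflection u hu _ hc) p = p + ∑ α,
          ((Real.cos t - 1) • (reInner u (slot α p) • inSlot α u +
            reInner (Complex.I • u) (slot α p) • inSlot α (Complex.I • u)) +
          Real.sin t • (reInner u (slot α p) • inSlot α (Complex.I • u) -
            reInner (Complex.I • u) (slot α p) • inSlot α u)) := by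
        have hs : ∀ v : Cn n, complexReflection u hu _ hc v = v +
            ((Real.cos t - 1) • (reInner u v • u +
            reInner (Complex.I • u) v • (Complex.I • u)) +
            Real.sin t • (reInner u v • (Complex.I • u) -
            reInner (Complex.I • u) v • u)) := by
          intro v
          rw [complexReflection_apply, reInner_I_left, reInner_apply]
          congr 1
          have e : ∀ (r : ℝ) (w : Cn n), r • w = (r : ℂ) • w := fun r w => rfl
          simp only [e, smul_smul, ← add_smul, ← sub_smul]
          congr 1
          have h1 := Complex.re_add_im (inner ℂ u v)
          rw [Complex.exp_mul_I]
          conv_lhs => rw [← h1]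
          push_cast
          linear_combination (Complex.sin t * (inner ℂ u v).im) * Complex.I_mul_I
        conv_lhs => rw [← sum_inSlot_slot (diagonal (complexReflection u hu _ hc) p)]
        conv_rhs => enter [1]; rw [← sum_inSlot_slot p]
        rw [← sum_add_distrib]
        refine sum_congr rfl fun α _ => ?_
        rw [slot_diagonal, hs]
        simp only [map_add, map_sub, map_smul]
      rw [LinearMap.dualMap_apply, hp]
      simp only [N₁, N₂, LinearMap.add_apply, LinearMap.smul_apply, LinearMap.sum_apply,
        LinearMap.sub_apply, LinearMap.smulRight_apply, LinearMap.id_apply, map_add, map_sum,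
        map_smul, map_sub, cov_apply, smul_eq_mul, Module.Dual.eval_apply, sum_add_distrib,
        mul_sum, mul_add, mul_sub, sum_sub_distrib]
      simp only [mul_comm]
      ring
  intro u hu
  rcases eq_or_ne u 0 with rfl | h0
  · simp
  · have hn : ‖u‖ ≠ 0 := norm_ne_zero_iff.2 h0
    -- The invariance condition is homogeneous of degree two in `u`, so unit vectors suffice.
    have hu' : ‖u‖⁻¹ • u ∈ coordSubspace J := Submodule.smul_mem _ ((‖u‖⁻¹ : ℝ) : ℂ) hu
    have h1 := hunit _ hu' (by rw [norm_smul, norm_inv, norm_norm, inv_mul_cancel₀ hn])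
    rw [smul_comm Complex.I] at h1
    simp only [transfer_smul_left, transfer_smul_right, LinearMap.smul_apply] at h1
    exact smul_right_injective _ (inv_ne_zero hn) (smul_right_injective _ (inv_ne_zero hn) h1)

/-! ### The four 2-forms and polynomials in them -/

theorem ι_mul_ι_mem_center {M : Type*} [AddCommGroup M] [Module ℝ M] (a b : M) :
    ι ℝ a * ι ℝ b ∈ Subalgebra.center ℝ (ExteriorAlgebra ℝ M) := by
  rw [Subalgebra.mem_center_iff]
  intro x
  induction x using ι_induction with
  | algebraMap r => exact Algebra.commutes r _
  | add x y hx hy => rw [add_mul, mul_add, hx, hy]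
  | ι_mul m x hx =>
    have h1 : ι ℝ m * (ι ℝ a * ι ℝ b) = ι ℝ a * ι ℝ b * ι ℝ m := by
      rw [← mul_assoc, eq_neg_of_add_eq_zero_left (ι_add_mul_swap m a), neg_mul, mul_assoc,
        eq_neg_of_add_eq_zero_left (ι_add_mul_swap m b), mul_neg, neg_neg, mul_assoc]
    rw [mul_assoc, hx, ← mul_assoc, h1, mul_assoc]

theorem cov_zero_single (j : Fin n) : cov 0 (EuclideanSpace.single j (1 : ℂ)) =
    Complex.reLm ∘ₗ coord j ∘ₗ LinearMap.fst ℝ (Cn n) (Cn n) :=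
  LinearMap.ext fun p => by
    rw [cov_apply, reInner_comm, reInner_single]; rfl

theorem cov_zero_I_single (j : Fin n) : cov 0 (Complex.I • EuclideanSpace.single j (1 : ℂ)) =
    Complex.imLm ∘ₗ coord j ∘ₗ LinearMap.fst ℝ (Cn n) (Cn n) :=
  LinearMap.ext fun p => by
    rw [cov_apply, reInner_comm, reInner_I_single]; rfl

theorem cov_one_single (j : Fin n) : cov 1 (EuclideanSpace.single j (1 : ℂ)) =
    Complex.reLm ∘ₗ coord j ∘ₗ LinearMap.snd ℝ (Cn n) (Cn n) :=
  LinearMap.ext fun p => by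
    rw [cov_apply, reInner_comm, reInner_single]; rfl

theorem cov_one_I_single (j : Fin n) : cov 1 (Complex.I • EuclideanSpace.single j (1 : ℂ)) =
    Complex.imLm ∘ₗ coord j ∘ₗ LinearMap.snd ℝ (Cn n) (Cn n) :=
  LinearMap.ext fun p => by
    rw [cov_apply, reInner_comm, reInner_I_single]; rfl

theorem dx_eq (j : Fin n) : dx j = ι ℝ (cov 0 (EuclideanSpace.single j (1 : ℂ))) := by
  rw [cov_zero_single]; rfl

theorem dy_eq (j : Fin n) : dy j = ι ℝ (cov 0 (Complex.I • EuclideanSpace.single j (1 : ℂ))) := by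
  rw [cov_zero_I_single]; rfl

theorem dξ_eq (j : Fin n) : dξ j = ι ℝ (cov 1 (EuclideanSpace.single j (1 : ℂ))) := by
  rw [cov_one_single]; rfl

theorem dη_eq (j : Fin n) : dη j = ι ℝ (cov 1 (Complex.I • EuclideanSpace.single j (1 : ℂ))) := by
  rw [cov_one_I_single]; rfl

/-- The summands at the index `j` of the four invariant `2`-forms. -/
def pairForm (a : Fin 4) (j : Fin n) : Forms n :=
  ![dx j * dy j, dx j * dη j - dy j * dξ j, dξ j * dη j, dx j * dξ j + dy j * dη j] a

/-- The forms `θ₀, θ₁, θ₂, ω_s`. -/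
def theta (n : ℕ) (a : Fin 4) : Forms n := ![θ₀ n, θ₁ n, θ₂ n, ωs n] a

theorem theta_eq_sum (a : Fin 4) : theta n a = ∑ j, pairForm a j := by
  fin_cases a <;> rfl

theorem pairForm_mem_center (a : Fin 4) (j : Fin n) :
    pairForm a j ∈ Subalgebra.center ℝ (Forms n) := by
  fin_cases a
  · exact ι_mul_ι_mem_center _ _
  · exact sub_mem (ι_mul_ι_mem_center _ _) (ι_mul_ι_mem_center _ _)
  · exact ι_mul_ι_mem_center _ _
  · exact add_mem (ι_mul_ι_mem_center _ _) (ι_mul_ι_mem_center _ _)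

theorem theta_mem_center (a : Fin 4) : theta n a ∈ Subalgebra.center ℝ (Forms n) := by
  rw [theta_eq_sum]
  exact sum_mem fun j _ => pairForm_mem_center a j

/-- Evaluation of polynomials at the forms `θ₀, θ₁, θ₂, ω_s`, as an algebra homomorphism. -/
def thetaEval (n : ℕ) : MvPolynomial (Fin 4) ℝ →ₐ[ℝ] Forms n :=
  -- The four 2-forms are central, so polynomials are evaluated in the center, which is commutative.
  (Subalgebra.center ℝ (Forms n)).val.comp
    (MvPolynomial.aeval fun a => (⟨theta n a, theta_mem_center a⟩ : Subalgebra.center ℝ (Forms n)))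

theorem thetaEval_X (a : Fin 4) : thetaEval n (MvPolynomial.X a) = theta n a := by
  simp [thetaEval]

theorem thetaEval_mul_comm (P : MvPolynomial (Fin 4) ℝ) (x : Forms n) :
    x * thetaEval n P = thetaEval n P * x :=
  Subalgebra.mem_center_iff.1 (Subtype.prop _) x

theorem evalForms_eq (P : MvPolynomial (Fin 4) ℝ) : evalForms n P = thetaEval n P := by
  conv_rhs => rw [P.as_sum, map_sum]
  refine sum_congr rfl fun m _ => ?_
  rw [MvPolynomial.monomial_eq, Finsupp.prod_fintype _ _ (fun i => pow_zero _),
    Fin.prod_univ_four]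
  simp only [← MvPolynomial.algebraMap_eq, Algebra.algebraMap_eq_smul_one, smul_mul_assoc, one_mul,
    map_smul, map_mul, map_pow, thetaEval_X]
  rfl

/-- For `α = β` every summand is a square of a covector, hence zero; for `α ≠ β` the sum is the
`J`-part of `ω_s` up to sign. -/
theorem symForm_eq (J : Finset (Fin n)) (α β : Fin 2) :
    ∃ c : Fin 4 → ℝ, symForm J α β = ∑ a, c a • ∑ j ∈ J, pairForm a j := by
  have h : ∀ α β, symForm J α β = ∑ j ∈ J, (ι ℝ (cov α (EuclideanSpace.single j (1 : ℂ))) *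
      ι ℝ (cov β (EuclideanSpace.single j (1 : ℂ))) +
      ι ℝ (cov α (Complex.I • EuclideanSpace.single j (1 : ℂ))) *
      ι ℝ (cov β (Complex.I • EuclideanSpace.single j (1 : ℂ)))) := fun α β =>
    sum_realIndex J fun v => ι ℝ (cov α v) * ι ℝ (cov β v)
  fin_cases α <;> fin_cases β
  · exact ⟨0, by simp [h]⟩
  · refine ⟨![0, 0, 0, 1], ?_⟩
    simp [Fin.sum_univ_four, pairForm, h, dx_eq, dy_eq, dξ_eq, dη_eq]
  · refine ⟨![0, 0, 0, -1], ?_⟩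
    simp only [Fin.sum_univ_four, pairForm, h, dx_eq, dy_eq, dξ_eq, dη_eq]
    simp only [Fin.mk_one, Fin.zero_eta, Fin.isValue, Matrix.cons_val, zero_smul, zero_add,
      neg_smul, one_smul, ← sum_neg_distrib]
    refine sum_congr rfl fun j _ => ?_
    rw [eq_neg_of_add_eq_zero_left (ι_add_mul_swap (cov 1 (EuclideanSpace.single j (1 : ℂ))) _),
      eq_neg_of_add_eq_zero_left
        (ι_add_mul_swap (cov 1 (Complex.I • EuclideanSpace.single j (1 : ℂ))) _)]
    abel
  · exact ⟨0, by simp [h]⟩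

/-- For `α = β` this is twice the `J`-part of `θ₀` or `θ₂`, and for either order of distinct slots
it is the `J`-part of `θ₁`. -/
theorem skewForm_eq (J : Finset (Fin n)) (α β : Fin 2) :
    ∃ c : Fin 4 → ℝ, skewForm J α β = ∑ a, c a • ∑ j ∈ J, pairForm a j := by
  have h : ∀ α β, skewForm J α β = ∑ j ∈ J, (ι ℝ (cov α (EuclideanSpace.single j (1 : ℂ))) *
      ι ℝ (cov β (Complex.I • EuclideanSpace.single j (1 : ℂ))) -
      ι ℝ (cov α (Complex.I • EuclideanSpace.single j (1 : ℂ))) *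
      ι ℝ (cov β (EuclideanSpace.single j (1 : ℂ)))) := fun α β => by
    rw [skewForm, sum_realIndex J fun v => ι ℝ (cov α v) * ι ℝ (cov β (Complex.I • v))]
    refine sum_congr rfl fun j _ => ?_
    rw [I_smul_I_smul, map_neg, map_neg, mul_neg, sub_eq_add_neg]
  have hs : ∀ (α β : Fin 2) (v w : Cn n),
      ι ℝ (cov α v) * ι ℝ (cov β w) = - (ι ℝ (cov β w) * ι ℝ (cov α v)) := fun α β v w =>
    eq_neg_of_add_eq_zero_left (ι_add_mul_swap _ _)
  fin_cases α <;> fin_cases β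
  · refine ⟨![2, 0, 0, 0], ?_⟩
    simp only [Fin.sum_univ_four, pairForm, h, dx_eq, dy_eq, dξ_eq, dη_eq]
    simp only [Fin.zero_eta, Fin.isValue, Matrix.cons_val, zero_smul, add_zero]
    rw [smul_sum]
    refine sum_congr rfl fun j _ => ?_
    rw [hs 0 0 (Complex.I • EuclideanSpace.single j (1 : ℂ)), two_smul]
    abel
  · refine ⟨![0, 1, 0, 0], ?_⟩
    simp [Fin.sum_univ_four, pairForm, h, dx_eq, dy_eq, dξ_eq, dη_eq]
  · refine ⟨![0, 1, 0, 0], ?_⟩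
    simp only [Fin.sum_univ_four, pairForm, h, dx_eq, dy_eq, dξ_eq, dη_eq]
    simp only [Fin.mk_one, Fin.zero_eta, Fin.isValue, Matrix.cons_val, zero_smul, add_zero,
      zero_add, one_smul]
    refine sum_congr rfl fun j _ => ?_
    rw [hs 1 0 (Complex.I • EuclideanSpace.single j (1 : ℂ)), hs 1 0]
    abel
  · refine ⟨![0, 0, 2, 0], ?_⟩
    simp only [Fin.sum_univ_four, pairForm, h, dx_eq, dy_eq, dξ_eq, dη_eq]
    simp only [Fin.mk_one, Fin.isValue, Matrix.cons_val, zero_smul, add_zero,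
      zero_add]
    rw [smul_sum]
    refine sum_congr rfl fun j _ => ?_
    rw [hs 1 1 (Complex.I • EuclideanSpace.single j (1 : ℂ)), two_smul]
    abel

/-- The span of the products of a `p`-form on the coordinates outside `J` with a monomial of
degree `k` in `θ₀, θ₁, θ₂, ω_s`, where `p + 2 k = d`. -/
def outerThetaSpan (J : Finset (Fin n)) (d : ℕ) : Submodule ℝ (Forms n) :=
  Submodule.span ℝ {x | ∃ (p : ℕ) (m : Fin 4 →₀ ℕ) (w : Forms n), w ∈ outerSpan J ^ p ∧
    p + 2 * m.degree = d ∧ x = w * thetaEval n (MvPolynomial.monomial m 1)}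

theorem coord_mem_outerSpan {J : Finset (Fin n)} {j : Fin n} (hj : j ∉ J) :
    dx j ∈ outerSpan J ∧ dy j ∈ outerSpan J ∧ dξ j ∈ outerSpan J ∧ dη j ∈ outerSpan J := by
  refine ⟨Submodule.subset_span ⟨0, j, 0, hj, ?_⟩, Submodule.subset_span ⟨0, j, 1, hj, ?_⟩,
    Submodule.subset_span ⟨1, j, 0, hj, ?_⟩, Submodule.subset_span ⟨1, j, 1, hj, ?_⟩⟩
  · rw [realBasis_zero, dx_eq]
  · rw [realBasis_one, dy_eq]
  · rw [realBasis_zero, dξ_eq]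
  · rw [realBasis_one, dη_eq]

theorem pairForm_mem_outerSpan {J : Finset (Fin n)} {j : Fin n} (hj : j ∉ J) (a : Fin 4) :
    pairForm a j ∈ outerSpan J ^ 2 := by
  obtain ⟨h1, h2, h3, h4⟩ := coord_mem_outerSpan hj
  rw [pow_two]
  fin_cases a
  · exact Submodule.mul_mem_mul h1 h2
  · exact sub_mem (Submodule.mul_mem_mul h1 h4) (Submodule.mul_mem_mul h2 h3)
  · exact Submodule.mul_mem_mul h3 h4
  · exact add_mem (Submodule.mul_mem_mul h1 h3) (Submodule.mul_mem_mul h2 h4)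

/-- The partial sum over `J` is the full form `theta n a` minus a 2-form in outer covectors, which
can be absorbed into `w`. Thus the invariants of `ℂᴶ` are traded for those of `ℂⁿ`. -/
theorem sum_pairForm_mul_mem (J : Finset (Fin n)) (d : ℕ) (a : Fin 4) {x : Forms n}
    (hx : x ∈ outerThetaSpan J d) : (∑ j ∈ J, pairForm a j) * x ∈ outerThetaSpan J (d + 2) := by
  induction hx using Submodule.span_induction with
  | zero => rw [mul_zero]; exact zero_mem _
  | add x y _ _ hx hy => rw [mul_add]; exact add_mem hx hy
  | smul c x _ hx => rw [mul_smul_comm]; exact Submodule.smul_mem _ _ hx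
  | mem x hx =>
    obtain ⟨p, m, w, hw, hd, rfl⟩ := hx
    have h1 : ∑ j ∈ J, pairForm a j = theta n a - ∑ j ∈ Jᶜ, pairForm a j := by
      rw [theta_eq_sum, ← sum_add_sum_compl J]; abel
    have h2 : theta n a * (w * thetaEval n (MvPolynomial.monomial m 1)) =
        w * thetaEval n (MvPolynomial.monomial (m + Finsupp.single a 1) 1) := by
      rw [← thetaEval_X, ← mul_assoc, ← thetaEval_mul_comm, mul_assoc, ← map_mul,
        MvPolynomial.X, MvPolynomial.monomial_mul, one_mul, add_comm]
    rw [h1, sub_mul, h2]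
    refine sub_mem (Submodule.subset_span ⟨p, _, w, hw, ?_, rfl⟩)
      (Submodule.subset_span ⟨p + 2, m, _, ?_, ?_, (mul_assoc _ _ _).symm⟩)
    · rw [map_add, Finsupp.degree_single]; omega
    · rw [add_comm, pow_add]
      exact Submodule.mul_mem_mul
        (sum_mem fun j hj => pairForm_mem_outerSpan (mem_compl.1 hj) a) hw
    · omega

theorem infInvariant_inf_le_outerThetaSpan (J : Finset (Fin n)) (d : ℕ) :
    infInvariant J ⊓ LinearMap.range (ι ℝ : Module.Dual ℝ (TCn n) →ₗ[ℝ] Forms n) ^ d ≤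
      outerThetaSpan J d := by
  refine infInvariant_inf_le (X := outerThetaSpan J) (fun d w hw => Submodule.subset_span ⟨d, 0, w, hw, by simp, by simp⟩)
    (fun d α β x hx => ?_) (fun d α β x hx => ?_) d
  · obtain ⟨c, hc⟩ := symForm_eq J α β
    rw [hc, sum_mul]
    refine sum_mem fun a _ => ?_
    rw [smul_mul_assoc]
    exact Submodule.smul_mem _ _ (sum_pairForm_mul_mem J d a hx)
  · obtain ⟨c, hc⟩ := skewForm_eq J α β
    rw [hc, sum_mul]
    refine sum_mem fun a _ => ?_
    rw [smul_mul_assoc]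
    exact Submodule.smul_mem _ _ (sum_pairForm_mul_mem J d a hx)

/-! ### Generators at a point and the forms fixed by a stabilizer -/

section FourCovectors

variable {M : Type*} [AddCommGroup M] [Module ℝ M] (a b c d : M)

/-- The span of four given covectors. -/
abbrev fourSpan : Submodule ℝ (ExteriorAlgebra ℝ M) :=
  Submodule.span ℝ {ι ℝ a, ι ℝ b, ι ℝ c, ι ℝ d}

/-- The span of the six products of two of four given covectors. -/
abbrev sixSpan : Submodule ℝ (ExteriorAlgebra ℝ M) :=
  Submodule.span ℝ {ι ℝ a * ι ℝ b, ι ℝ a * ι ℝ c, ι ℝ a * ι ℝ d, ι ℝ b * ι ℝ c, ι ℝ b * ι ℝ d,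
    ι ℝ c * ι ℝ d}

theorem ι_mul_swap (x y : M) : ι ℝ x * ι ℝ y = -(ι ℝ y * ι ℝ x) :=
  eq_neg_of_add_eq_zero_left (ι_add_mul_swap _ _)

theorem ι_mul_swap_assoc (x y : M) (z : ExteriorAlgebra ℝ M) :
    ι ℝ x * (ι ℝ y * z) = -(ι ℝ y * (ι ℝ x * z)) := by
  rw [← mul_assoc, ι_mul_swap, neg_mul, mul_assoc]

theorem ι_mul_self_assoc (x : M) (z : ExteriorAlgebra ℝ M) : ι ℝ x * (ι ℝ x * z) = 0 := by
  rw [← mul_assoc, ι_sq_zero, zero_mul]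

theorem fourSpan_mul_fourSpan_le : fourSpan a b c d * fourSpan a b c d ≤ sixSpan a b c d := by
  rw [Submodule.span_mul_span, Submodule.span_le]
  have hm : ∀ x ∈ ({ι ℝ a * ι ℝ b, ι ℝ a * ι ℝ c, ι ℝ a * ι ℝ d, ι ℝ b * ι ℝ c, ι ℝ b * ι ℝ d,
    ι ℝ c * ι ℝ d} : Set (ExteriorAlgebra ℝ M)), x ∈ sixSpan a b c d := fun x hx =>
    Submodule.subset_span hx
  rintro _ ⟨x, hx, y, hy, rfl⟩
  simp only [Set.mem_insert_iff, Set.mem_singleton_iff] at hx hy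
  rcases hx with rfl | rfl | rfl | rfl <;> rcases hy with rfl | rfl | rfl | rfl <;>
    simp only [SetLike.mem_coe, ι_sq_zero, zero_mem, ι_mul_swap b a, ι_mul_swap c a,
      ι_mul_swap d a, ι_mul_swap c b, ι_mul_swap d b, ι_mul_swap d c, neg_mem_iff] <;>
    exact hm _ (by simp)

theorem sixSpan_mul_sixSpan_le :
    sixSpan a b c d * sixSpan a b c d ≤ Submodule.span ℝ {ι ℝ a * ι ℝ b * ι ℝ c * ι ℝ d} := by
  rw [Submodule.span_mul_span, Submodule.span_le]
  rintro _ ⟨x, hx, y, hy, rfl⟩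
  simp only [Set.mem_insert_iff, Set.mem_singleton_iff] at hx hy
  rcases hx with rfl | rfl | rfl | rfl | rfl | rfl <;>
    rcases hy with rfl | rfl | rfl | rfl | rfl | rfl <;>
    simp [mul_assoc, ι_mul_swap c b,
      ι_mul_swap d b, ι_mul_swap d c, ι_mul_swap_assoc b a, ι_mul_swap_assoc c a,
      ι_mul_swap_assoc d a, ι_mul_swap_assoc c b, ι_mul_swap_assoc d b, ι_mul_swap_assoc d c,
      ι_mul_self_assoc, Submodule.mem_span_singleton_self]

theorem span_mul_sixSpan_eq_bot :
    Submodule.span ℝ {ι ℝ a * ι ℝ b * ι ℝ c * ι ℝ d} * sixSpan a b c d = ⊥ := by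
  rw [eq_bot_iff, Submodule.span_mul_span, Submodule.span_le]
  rintro _ ⟨x, hx, y, hy, rfl⟩
  simp only [Set.mem_insert_iff, Set.mem_singleton_iff] at hx hy
  rcases hx with rfl
  rcases hy with rfl | rfl | rfl | rfl | rfl | rfl <;>
    simp [mul_assoc,
      ι_mul_swap d b, ι_mul_swap d c, ι_mul_swap_assoc b a, ι_mul_swap_assoc c a,
      ι_mul_swap_assoc d a, ι_mul_swap_assoc c b, ι_mul_swap_assoc d b, ι_mul_swap_assoc d c,
      ι_mul_self_assoc]

end FourCovectors

theorem γ₁_eq (z : Cn n) : γ₁ z = ι ℝ (cov 0 z) := by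
  conv_rhs => rw [eq_sum_single (mem_coordSubspace_univ z)]
  simp only [γ₁, dx_eq, dy_eq, map_sum, map_add, map_smul]

theorem β₁_eq (z : Cn n) : β₁ z = ι ℝ (cov 1 z) := by
  conv_rhs => rw [eq_sum_single (mem_coordSubspace_univ z)]
  simp only [β₁, dξ_eq, dη_eq, map_sum, map_add, map_smul]

theorem γ₂_eq (z : Cn n) : γ₂ z = ι ℝ (cov 0 (Complex.I • z)) := by
  conv_rhs => rw [eq_sum_single (mem_coordSubspace_univ z)]
  simp only [γ₂, dx_eq, dy_eq, smul_sum, smul_add, smul_comm Complex.I (_ : ℝ), I_smul_I_smul,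
    map_sum, map_add, map_smul, map_neg, smul_neg, sub_eq_add_neg]

theorem β₂_eq (z : Cn n) : β₂ z = ι ℝ (cov 1 (Complex.I • z)) := by
  conv_rhs => rw [eq_sum_single (mem_coordSubspace_univ z)]
  simp only [β₂, dξ_eq, dη_eq, smul_sum, smul_add, smul_comm Complex.I (_ : ℝ), I_smul_I_smul,
    map_sum, map_add, map_smul, map_neg, smul_neg, sub_eq_add_neg]

/-- The products of `γ₁, γ₂, β₁, β₂` occurring as coefficients. -/
def invGen (z : Cn n) : Fin 8 → Forms n :=
  ![γ₁ z * γ₂ z * β₁ z * β₂ z, γ₁ z * γ₂ z, γ₁ z * β₁ z, γ₁ z * β₂ z, γ₂ z * β₁ z, γ₂ z * β₂ z,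
    β₁ z * β₂ z, 1]

/-- The degrees of the polynomials which are the coefficients of `invGen`. -/
def invDeg (n : ℕ) : Fin 8 → ℤ := ![n - 2, n - 1, n - 1, n - 1, n - 1, n - 1, n - 1, n]

/-- The form with given polynomial coefficients with respect to `invGen`. -/
def combine (z : Cn n) : (Fin 8 → MvPolynomial (Fin 4) ℝ) →ₗ[ℝ] Forms n :=
  ∑ i, LinearMap.mulLeft ℝ (invGen z i) ∘ₗ (thetaEval n).toLinearMap ∘ₗ LinearMap.proj i

theorem combine_apply (z : Cn n) (P : Fin 8 → MvPolynomial (Fin 4) ℝ) :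
    combine z P = ∑ i, invGen z i * thetaEval n (P i) := by
  simp [combine]

theorem combine_single (z : Cn n) (i : Fin 8) (P : MvPolynomial (Fin 4) ℝ) :
    combine z (Pi.single i P) = invGen z i * thetaEval n P := by
  rw [combine_apply, sum_eq_single i]
  · simp
  · intro j _ hj
    simp [hj]
  · simp

/-- The tuples of homogeneous polynomials of the right degrees. -/
def homTuples (n : ℕ) : Submodule ℝ (Fin 8 → MvPolynomial (Fin 4) ℝ) :=
  Submodule.pi Set.univ fun i => HomPoly (invDeg n i)

theorem monomial_mem_homPoly (m : Fin 4 →₀ ℕ) (c : ℝ) {d : ℤ} (hd : (m.degree : ℤ) = d) :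
    MvPolynomial.monomial m c ∈ HomPoly d := by
  intro m' hm'
  rw [MvPolynomial.coeff_monomial] at hm'
  split_ifs at hm' with h
  · rw [← h, hd]
  · exact absurd rfl hm'

theorem invGen_mul_mem (z : Cn n) (i : Fin 8) (m : Fin 4 →₀ ℕ) (hm : (m.degree : ℤ) = invDeg n i) :
    invGen z i * thetaEval n (MvPolynomial.monomial m 1) ∈ (homTuples n).map (combine z) := by
  refine ⟨Pi.single i (MvPolynomial.monomial m 1), ?_, combine_single _ _ _⟩
  intro j _
  by_cases h : j = i
  · subst h
    rw [Pi.single_eq_same]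
    exact monomial_mem_homPoly m 1 hm
  · rw [Pi.single_eq_of_ne h]
    exact zero_mem _

/-- A form invariant under the stabilizer of `e_j` is a combination of the generators at `e_j`. -/
theorem outerThetaSpan_le (j₀ : Fin n) :
    outerThetaSpan (univ.erase j₀) (2 * n) ≤
      (homTuples n).map (combine (EuclideanSpace.single j₀ (1 : ℂ))) := by
  set e : Cn n := EuclideanSpace.single j₀ (1 : ℂ) with he
  have hW : outerSpan (univ.erase j₀) ≤
      fourSpan (cov 0 e) (cov 0 (Complex.I • e)) (cov 1 e) (cov 1 (Complex.I • e)) := by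
    refine Submodule.span_le.2 ?_
    rintro _ ⟨α, j, ε, hj, rfl⟩
    have hj' : j = j₀ := by simpa using hj
    subst hj'
    refine Submodule.subset_span ?_
    fin_cases α <;> fin_cases ε <;> simp [realBasis_zero, realBasis_one, he]
  have hg (i : Fin 8) := invGen_mul_mem e i
  set R := (homTuples n).map (combine e) with hR
  refine Submodule.span_le.2 ?_
  rintro _ ⟨p, m, w, hw, hd, rfl⟩
  replace hw := pow_le_pow_left' hW p hw
  -- The total degree `2 * n` is even, so an even number of the four covectors at `e` occurs.
  obtain ⟨q, rfl⟩ : ∃ q, p = 2 * q := ⟨n - m.degree, by omega⟩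
  rw [pow_mul, pow_two] at hw
  replace hw := pow_le_pow_left' (fourSpan_mul_fourSpan_le _ _ _ _) q hw
  have hmul : ∀ S : Set (Forms n), w ∈ Submodule.span ℝ S →
      (∀ s ∈ S, s * thetaEval n (MvPolynomial.monomial m 1) ∈ R) →
      w * thetaEval n (MvPolynomial.monomial m 1) ∈ R := by
    intro S hS h
    have : Submodule.span ℝ S ≤
        R.comap (LinearMap.mulRight ℝ (thetaEval n (MvPolynomial.monomial m 1))) :=
      Submodule.span_le.2 h
    exact this hS
  match q with
  | 0 =>
    rw [pow_zero, Submodule.one_eq_span] at hw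
    refine hmul _ hw ?_
    rintro _ rfl
    exact hg 7 m (by simp [invDeg]; omega)
  | 1 =>
    rw [pow_one] at hw
    refine hmul _ hw ?_
    have hm : (m.degree : ℤ) = n - 1 := by omega
    have h1 := hg 1 m hm
    have h2 := hg 2 m hm
    have h3 := hg 3 m hm
    have h4 := hg 4 m hm
    have h5 := hg 5 m hm
    have h6 := hg 6 m hm
    simp only [invGen, Matrix.cons_val, γ₁_eq, γ₂_eq, β₁_eq, β₂_eq] at h1 h2 h3 h4 h5 h6
    intro s hs
    simp only [Set.mem_insert_iff, Set.mem_singleton_iff] at hs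
    rcases hs with rfl | rfl | rfl | rfl | rfl | rfl <;> assumption
  | 2 =>
    rw [pow_two] at hw
    refine hmul _ (sixSpan_mul_sixSpan_le _ _ _ _ hw) ?_
    have hm : (m.degree : ℤ) = n - 2 := by omega
    have h0 := hg 0 m hm
    simp only [invGen, Matrix.cons_val, γ₁_eq, γ₂_eq, β₁_eq, β₂_eq] at h0
    rintro _ rfl
    exact h0
  -- A product of at least six factors from a span of four covectors vanishes.
  | q + 3 =>
    have h3 : sixSpan (cov 0 e) (cov 0 (Complex.I • e)) (cov 1 e) (cov 1 (Complex.I • e)) ^ 3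
        ≤ ⊥ := by
      rw [pow_succ, pow_two, ← span_mul_sixSpan_eq_bot (cov 0 e) (cov 0 (Complex.I • e)) (cov 1 e)
        (cov 1 (Complex.I • e))]
      exact mul_le_mul' (sixSpan_mul_sixSpan_le _ _ _ _) le_rfl
    rw [pow_add] at hw
    have h4 := mul_le_mul' (le_refl (sixSpan (cov 0 e) (cov 0 (Complex.I • e)) (cov 1 e)
      (cov 1 (Complex.I • e)) ^ q)) h3 hw
    rw [Submodule.mul_bot, Submodule.mem_bot] at h4
    rw [h4, zero_mul]
    exact zero_mem _

/-- A form invariant under the whole unitary group is a polynomial in `θ₀, θ₁, θ₂, ω_s`. -/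
theorem outerThetaSpan_univ_le :
    outerThetaSpan univ (2 * n) ≤ (HomPoly (n : ℤ)).map (thetaEval n).toLinearMap := by
  refine Submodule.span_le.2 ?_
  rintro _ ⟨p, m, w, hw, hd, rfl⟩
  have h0 : outerSpan (univ : Finset (Fin n)) = ⊥ := by
    rw [outerSpan, Submodule.span_eq_bot]
    rintro _ ⟨α, j, ε, hj, rfl⟩
    exact absurd (mem_univ j) hj
  rw [h0] at hw
  rcases p with _ | p
  · rw [pow_zero, Submodule.mem_one] at hw
    obtain ⟨r, rfl⟩ := hw
    rw [← Algebra.smul_def]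
    exact Submodule.smul_mem _ _ ⟨_, monomial_mem_homPoly m 1 (by omega), rfl⟩
  · rw [pow_succ, Submodule.mul_bot, Submodule.mem_bot] at hw
    rw [hw, zero_mul]
    exact zero_mem _

/-! ### Equivariance of the generators -/

theorem cov_comp_diagonal (g : Cn n ≃ₗᵢ[ℂ] Cn n) (α : Fin 2) (w : Cn n) :
    (diagonal g).dualMap (cov α w) = cov α (g.symm w) := by
  refine LinearMap.ext fun p => ?_
  rw [LinearMap.dualMap_apply, cov_apply, cov_apply, slot_diagonal, reInner_apply, reInner_apply]
  conv_lhs => rw [← g.apply_symm_apply w, g.inner_map_map]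

theorem map_diagonal_ι_cov (g : Cn n ≃ₗᵢ[ℂ] Cn n) (α : Fin 2) (w : Cn n) :
    ExteriorAlgebra.map (diagonal g).dualMap (ι ℝ (cov α w)) = ι ℝ (cov α (g.symm w)) := by
  rw [map_apply_ι, cov_comp_diagonal]

/-- The trace of a bilinear map is independent of the orthonormal basis. -/
theorem sum_realBasis_isometry {N : Type*} [AddCommGroup N] [Module ℝ N]
    (B : Cn n →ₗ[ℝ] Cn n →ₗ[ℝ] N) (g : Cn n ≃ₗᵢ[ℂ] Cn n) :
    ∑ k ∈ realIndex univ, B (g (realBasis k)) (g (realBasis k)) =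
      ∑ k ∈ realIndex univ, B (realBasis k) (realBasis k) := by
  have h1 : ∀ k, B (g (realBasis k)) (g (realBasis k)) = ∑ l ∈ realIndex univ,
      reInner (g (realBasis k)) (realBasis l) • B (realBasis l) (g (realBasis k)) := fun k =>
    (sum_reInner_smul (mem_coordSubspace_univ (g (realBasis k)))
      (B.flip (g (realBasis k)))).symm
  simp only [h1]
  rw [sum_comm]
  refine sum_congr rfl fun l _ => ?_
  have h2 := sum_reInner_smul (mem_coordSubspace_univ (g.symm (realBasis l)))
    (B (realBasis l) ∘ₗ (g.toLinearEquiv.toLinearMap.restrictScalars ℝ))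
  have h3 : (B (realBasis l) ∘ₗ (g.toLinearEquiv.toLinearMap.restrictScalars ℝ))
      (g.symm (realBasis l)) = B (realBasis l) (realBasis l) := by simp
  rw [h3] at h2
  rw [← h2]
  refine sum_congr rfl fun k _ => ?_
  have h4 : reInner (g (realBasis k)) (realBasis l) =
      reInner (g.symm (realBasis l)) (realBasis k) := by
    rw [reInner_comm, reInner_apply, reInner_apply]
    conv_lhs => rw [← g.apply_symm_apply (realBasis l), g.inner_map_map]
  rw [h4]
  rfl

theorem map_diagonal_symForm (g : Cn n ≃ₗᵢ[ℂ] Cn n) (α β : Fin 2) :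
    ExteriorAlgebra.map (diagonal g).dualMap (symForm univ α β) = symForm univ α β := by
  simp only [symForm, map_sum, map_mul, map_diagonal_ι_cov]
  exact sum_realBasis_isometry
    ((LinearMap.mul ℝ (Forms n)).compl₁₂ (ι ℝ ∘ₗ cov α) (ι ℝ ∘ₗ cov β)) g.symm

theorem map_diagonal_skewForm (g : Cn n ≃ₗᵢ[ℂ] Cn n) (α β : Fin 2) :
    ExteriorAlgebra.map (diagonal g).dualMap (skewForm univ α β) = skewForm univ α β := by
  simp only [skewForm, map_sum, map_mul, map_diagonal_ι_cov, map_smul]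
  exact sum_realBasis_isometry
    ((LinearMap.mul ℝ (Forms n)).compl₁₂ (ι ℝ ∘ₗ cov α) (ι ℝ ∘ₗ cov β ∘ₗ
      (LinearMap.lsmul ℂ (Cn n) Complex.I).restrictScalars ℝ)) g.symm

theorem theta_eq_symForm_or_skewForm (a : Fin 4) : ∃ (c : ℝ) (α β : Fin 2),
    theta n a = c • symForm univ α β ∨ theta n a = c • skewForm univ α β := by
  have h : ∀ α β : Fin 2, skewForm (univ : Finset (Fin n)) α β =
      ∑ j, (ι ℝ (cov α (EuclideanSpace.single j (1 : ℂ))) *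
      ι ℝ (cov β (Complex.I • EuclideanSpace.single j (1 : ℂ))) -
      ι ℝ (cov α (Complex.I • EuclideanSpace.single j (1 : ℂ))) *
      ι ℝ (cov β (EuclideanSpace.single j (1 : ℂ)))) := fun α β => by
    rw [skewForm, sum_realIndex univ fun v => ι ℝ (cov α v) * ι ℝ (cov β (Complex.I • v))]
    refine sum_congr rfl fun j _ => ?_
    rw [I_smul_I_smul, map_neg, map_neg, mul_neg, sub_eq_add_neg]
  fin_cases a
  · refine ⟨1 / 2, 0, 0, Or.inr ?_⟩
    change θ₀ n = _
    rw [θ₀, h, smul_sum]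
    refine sum_congr rfl fun j _ => ?_
    rw [ι_mul_swap (cov 0 (Complex.I • _)), dx_eq, dy_eq, sub_neg_eq_add, ← two_smul ℝ, smul_smul]
    norm_num
  · refine ⟨1, 0, 1, Or.inr ?_⟩
    change θ₁ n = _
    rw [θ₁, h, one_smul]
    refine sum_congr rfl fun j _ => ?_
    rw [dx_eq, dy_eq, dξ_eq, dη_eq]
  · refine ⟨1 / 2, 1, 1, Or.inr ?_⟩
    change θ₂ n = _
    rw [θ₂, h, smul_sum]
    refine sum_congr rfl fun j _ => ?_
    rw [ι_mul_swap (cov 1 (Complex.I • _)), dξ_eq, dη_eq, sub_neg_eq_add, ← two_smul ℝ, smul_smul]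
    norm_num
  · refine ⟨1, 0, 1, Or.inl ?_⟩
    change ωs n = _
    rw [ωs, symForm, one_smul, sum_realIndex univ fun v => ι ℝ (cov 0 v) * ι ℝ (cov 1 v)]
    refine sum_congr rfl fun j _ => ?_
    rw [dx_eq, dy_eq, dξ_eq, dη_eq]

theorem map_diagonal_theta (g : Cn n ≃ₗᵢ[ℂ] Cn n) (a : Fin 4) :
    ExteriorAlgebra.map (diagonal g).dualMap (theta n a) = theta n a := by
  obtain ⟨c, α, β, h | h⟩ := theta_eq_symForm_or_skewForm (n := n) a <;> rw [h, map_smul]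
  · rw [map_diagonal_symForm]
  · rw [map_diagonal_skewForm]

theorem map_diagonal_thetaEval (g : Cn n ≃ₗᵢ[ℂ] Cn n) (P : MvPolynomial (Fin 4) ℝ) :
    ExteriorAlgebra.map (diagonal g).dualMap (thetaEval n P) = thetaEval n P := by
  have : (ExteriorAlgebra.map (diagonal g).dualMap).comp (thetaEval n) = thetaEval n :=
    MvPolynomial.algHom_ext fun a => by
      rw [AlgHom.comp_apply, thetaEval_X, map_diagonal_theta]
  exact DFunLike.congr_fun this P

theorem map_diagonal_invGen (g : Cn n ≃ₗᵢ[ℂ] Cn n) (z : Cn n) (i : Fin 8) :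
    ExteriorAlgebra.map (diagonal g).dualMap (invGen (g z) i) = invGen z i := by
  fin_cases i <;>
    simp [invGen, γ₁_eq, γ₂_eq, β₁_eq, β₂_eq, cov_comp_diagonal]

/-- The coefficients do not change, so a formula at `e_j` is transported to every unit vector. -/
theorem map_diagonal_combine (g : Cn n ≃ₗᵢ[ℂ] Cn n) (z : Cn n)
    (P : Fin 8 → MvPolynomial (Fin 4) ℝ) :
    ExteriorAlgebra.map (diagonal g).dualMap (combine (g z) P) = combine z P := by
  simp only [combine_apply, map_sum, map_mul, map_diagonal_invGen, map_diagonal_thetaEval]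

/-! ### Independence of the four 2-forms in low degree -/

/-- The covectors `dx_j, dy_j, dξ_j, dη_j`. -/
def coordForm (a : Fin 4) (j : Fin n) : Forms n := ![dx j, dy j, dξ j, dη j] a

/-- The index of a covector in the basis `covBasis`. -/
def coordIndex (a : Fin 4) (j : Fin n) : Fin 2 × Fin n × Fin 2 :=
  (![0, 0, 1, 1] a, j, ![0, 1, 0, 1] a)

/-- Contraction with the coordinate vector dual to `coordForm a j`. -/
def coordAnn (a : Fin 4) (j : Fin n) : Module.End ℝ (Forms n) :=
  CliffordAlgebra.contractLeft (covBasis.coord (coordIndex a j))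

theorem coordForm_eq (a : Fin 4) (j : Fin n) : coordForm a j = ι ℝ (covBasis (coordIndex a j)) := by
  rw [covBasis_apply]
  fin_cases a
  · exact (dx_eq j).trans (by simp [coordIndex, realBasis_zero])
  · exact (dy_eq j).trans (by simp [coordIndex, realBasis_one])
  · exact (dξ_eq j).trans (by simp [coordIndex, realBasis_zero])
  · exact (dη_eq j).trans (by simp [coordIndex, realBasis_one])

theorem coordIndex_inj {a b : Fin 4} {j k : Fin n} :
    coordIndex a j = coordIndex b k ↔ a = b ∧ j = k := by
  simp only [coordIndex, Prod.mk.injEq]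
  fin_cases a <;> fin_cases b <;> simp

theorem coordAnn_coordForm_mul (a b : Fin 4) (j k : Fin n) (x : Forms n) :
    coordAnn a j (coordForm b k * x) =
      (if a = b ∧ j = k then x else 0) - coordForm b k * coordAnn a j x := by
  rw [coordForm_eq, coordAnn, contractLeft_ι_mul', Module.Basis.coord_apply,
    Module.Basis.repr_self, Finsupp.single_apply]
  congr 1
  by_cases h : a = b ∧ j = k
  · rw [if_pos (coordIndex_inj.2 ⟨h.1.symm, h.2.symm⟩), if_pos h, one_smul]
  · rw [if_neg fun e => h ((coordIndex_inj.1 e).imp Eq.symm Eq.symm), if_neg h, zero_smul]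

theorem coordAnn_one (a : Fin 4) (j : Fin n) : coordAnn a j 1 = 0 :=
  CliffordAlgebra.contractLeft_one _ _

theorem coordAnn_coordForm (a b : Fin 4) (j k : Fin n) :
    coordAnn a j (coordForm b k) = if a = b ∧ j = k then 1 else 0 := by
  have := coordAnn_coordForm_mul a b j k 1
  rwa [mul_one, coordAnn_one, mul_zero, sub_zero] at this

theorem coordForm_mul_self (a : Fin 4) (j : Fin n) : coordForm a j * coordForm a j = 0 := by
  rw [coordForm_eq, ι_sq_zero]

theorem coordForm_mul_self_assoc (a : Fin 4) (j : Fin n) (x : Forms n) :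
    coordForm a j * (coordForm a j * x) = 0 := by
  rw [coordForm_eq, ι_mul_self_assoc]

theorem coordForm_swap_assoc (a b : Fin 4) (j k : Fin n) (x : Forms n) :
    coordForm a j * (coordForm b k * x) = - (coordForm b k * (coordForm a j * x)) := by
  rw [coordForm_eq, coordForm_eq, ι_mul_swap_assoc]

theorem pairForm_eq (a : Fin 4) (j : Fin n) : pairForm a j =
    ![coordForm 0 j * coordForm 1 j, coordForm 0 j * coordForm 3 j - coordForm 1 j * coordForm 2 j,
      coordForm 2 j * coordForm 3 j, coordForm 0 j * coordForm 2 j + coordForm 1 j * coordForm 3 j]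
      a := rfl

/-- The form `dx_j ∧ dy_j ∧ dξ_j ∧ dη_j`. -/
def topForm (j : Fin n) : Forms n :=
  coordForm 0 j * (coordForm 1 j * (coordForm 2 j * coordForm 3 j))

theorem topForm_mul_coordForm (a : Fin 4) (j : Fin n) (x : Forms n) :
    topForm j * (coordForm a j * x) = 0 := by
  fin_cases a <;>
    simp [topForm, mul_assoc, coordForm_mul_self_assoc, coordForm_swap_assoc 3 0,
      coordForm_swap_assoc 2 0, coordForm_swap_assoc 1 0, coordForm_swap_assoc 3 1,
      coordForm_swap_assoc 2 1, coordForm_swap_assoc 3 2]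

theorem coordAnn_pairForm_mul_of_ne (a b : Fin 4) {j k : Fin n} (h : j ≠ k) (x : Forms n) :
    coordAnn a j (pairForm b k * x) = pairForm b k * coordAnn a j x := by
  rw [pairForm_eq]
  fin_cases b <;>
    simp [sub_mul, add_mul, mul_assoc, coordAnn_coordForm_mul, h]

/-- The contraction of a theta form with a coordinate vector. -/
def thetaAnn (a b : Fin 4) : Fin 4 → ℝ :=
  ![![![0, 1, 0, 0], ![0, 0, 0, 1], ![0, 0, 0, 0], ![0, 0, 1, 0]],
    ![![-1, 0, 0, 0], ![0, 0, -1, 0], ![0, 0, 0, 0], ![0, 0, 0, 1]],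
    ![![0, 0, 0, 0], ![0, 1, 0, 0], ![0, 0, 0, 1], ![-1, 0, 0, 0]],
    ![![0, 0, 0, 0], ![-1, 0, 0, 0], ![0, 0, -1, 0], ![0, -1, 0, 0]]] a b

theorem coordAnn_pairForm_mul (a b : Fin 4) (j : Fin n) (x : Forms n) :
    coordAnn a j (pairForm b j * x) =
      (∑ c, thetaAnn a b c • coordForm c j) * x + pairForm b j * coordAnn a j x := by
  rw [pairForm_eq]
  fin_cases a <;> fin_cases b <;>
    simp [sub_mul, add_mul, mul_sub, mul_assoc, coordAnn_coordForm_mul, thetaAnn,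
      Fin.sum_univ_four] <;>
    abel

theorem coordAnn_theta_mul (a b : Fin 4) (j : Fin n) (x : Forms n) :
    coordAnn a j (theta n b * x) =
      (∑ c, thetaAnn a b c • coordForm c j) * x + theta n b * coordAnn a j x := by
  have h : coordAnn a j ((∑ k ∈ univ.erase j, pairForm b k) * x) =
      (∑ k ∈ univ.erase j, pairForm b k) * coordAnn a j x := by
    rw [sum_mul, map_sum, sum_mul]
    exact sum_congr rfl fun k hk => coordAnn_pairForm_mul_of_ne a b (ne_of_mem_erase hk).symm x
  rw [theta_eq_sum, ← add_sum_erase _ _ (mem_univ j), add_mul, map_add, coordAnn_pairForm_mul, h,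
    add_mul, add_assoc]

/-- A second order contraction which is dual to a theta form. -/
def pairAnn (a : Fin 4) (j : Fin n) : Module.End ℝ (Forms n) :=
  -- The index pairs are `(x, y)`, `(x, η)`, `(ξ, η)`, `(x, ξ)`: each occurs in exactly one of the
  -- four 2-forms, there with coefficient one.
  coordAnn (![1, 3, 3, 2] a) j * coordAnn (![0, 0, 2, 0] a) j

theorem topForm_mul_sum_coordForm (c : Fin 4 → ℝ) (j : Fin n) (x : Forms n) :
    topForm j * ((∑ a, c a • coordForm a j) * x) = 0 := by
  rw [sum_mul, mul_sum]
  refine sum_eq_zero fun a _ => ?_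
  rw [smul_mul_assoc, mul_smul_comm, topForm_mul_coordForm, smul_zero]

theorem topForm_mul_coordAnn_sum (a : Fin 4) (c : Fin 4 → ℝ) (j : Fin n) (x : Forms n) :
    topForm j * coordAnn a j ((∑ b, c b • coordForm b j) * x) = c a • (topForm j * x) := by
  have h : coordAnn a j ((∑ b, c b • coordForm b j) * x) =
      c a • x - (∑ b, c b • coordForm b j) * coordAnn a j x := by
    rw [sum_mul, sum_mul, map_sum]
    have h' : ∀ b, coordAnn a j (c b • coordForm b j * x) =
        (if a = b then c b • x else 0) - c b • coordForm b j * coordAnn a j x := by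
      intro b
      rw [smul_mul_assoc, map_smul, coordAnn_coordForm_mul, smul_sub, smul_mul_assoc]
      by_cases h : a = b <;> simp [h]
    simp only [h', sum_sub_distrib, sum_ite_eq, mem_univ, if_true]
  rw [h, mul_sub, topForm_mul_sum_coordForm, sub_zero, mul_smul_comm]

theorem topForm_mul_theta (a : Fin 4) (j : Fin n) (x : Forms n) :
    topForm j * (theta n a * x) = theta n a * (topForm j * x) := by
  rw [← mul_assoc, ← mul_assoc]
  exact congrArg (· * x) (Subalgebra.mem_center_iff.1 (theta_mem_center a) (topForm j))

theorem topForm_mul_pairAnn_theta_mul (a b : Fin 4) (j : Fin n) (x : Forms n) :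
    topForm j * pairAnn a j (theta n b * x) =
      (if a = b then topForm j * x else 0) + theta n b * (topForm j * pairAnn a j x) := by
  rw [pairAnn, Module.End.mul_apply, coordAnn_theta_mul, map_add, coordAnn_theta_mul, mul_add,
    mul_add, topForm_mul_coordAnn_sum, topForm_mul_sum_coordForm, zero_add, topForm_mul_theta]
  congr 1
  fin_cases a <;> fin_cases b <;> simp [thetaAnn]

/-- After multiplication by `topForm j`, a double contraction acts on polynomials as `∂/∂θ_a`.
Contracting two different factors leaves covectors at `j`, which `topForm j` kills; only contracting
one factor twice survives. -/
theorem topForm_mul_pairAnn_thetaEval_mul (a : Fin 4) (j : Fin n) (P : MvPolynomial (Fin 4) ℝ)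
    {T : Forms n} (hT : ∀ a, coordAnn a j T = 0) :
    topForm j * pairAnn a j (thetaEval n P * T) =
      thetaEval n (MvPolynomial.pderiv a P) * (topForm j * T) := by
  induction P using MvPolynomial.induction_on with
  | C r =>
    rw [MvPolynomial.pderiv_C, map_zero, zero_mul, ← MvPolynomial.algebraMap_eq, AlgHom.commutes,
      ← Algebra.smul_def, map_smul, pairAnn, Module.End.mul_apply, hT, map_zero, smul_zero,
      mul_zero]
  | add P Q hP hQ => rw [map_add, add_mul, map_add, mul_add, hP, hQ, map_add, map_add, add_mul]
  | mul_X P b hP =>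
    have hX : thetaEval n (MvPolynomial.X b * P) = theta n b * thetaEval n P := by
      rw [map_mul, thetaEval_X]
    rw [mul_comm P, hX, mul_assoc, topForm_mul_pairAnn_theta_mul, hP,
      MvPolynomial.pderiv_mul, MvPolynomial.pderiv_X, map_add, map_mul, map_mul, thetaEval_X,
      add_mul, mul_assoc (theta n b)]
    congr 1
    by_cases h : a = b
    · subst h
      rw [if_pos rfl, Pi.single_eq_same, map_one, one_mul, ← mul_assoc, ← mul_assoc,
        thetaEval_mul_comm]
    · rw [if_neg h, Pi.single_eq_of_ne (Ne.symm h), map_zero, zero_mul, zero_mul]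

theorem pderiv_mem_homPoly {P : MvPolynomial (Fin 4) ℝ} {d : ℤ} (hP : P ∈ HomPoly d) (a : Fin 4) :
    MvPolynomial.pderiv a P ∈ HomPoly (d - 1) := by
  intro m hm
  rw [MvPolynomial.coeff_pderiv] at hm
  have := hP _ (left_ne_zero_of_mul hm)
  rw [map_add, Finsupp.degree_single] at this
  push_cast at this
  omega

theorem eq_zero_of_pderiv_eq_zero {P : MvPolynomial (Fin 4) ℝ} {d : ℤ} (hP : P ∈ HomPoly d)
    (hd : 0 < d) (h : ∀ a, MvPolynomial.pderiv a P = 0) : P = 0 := by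
  ext m
  rw [MvPolynomial.coeff_zero]
  by_contra hm
  have hdeg := hP m hm
  obtain ⟨a, ha⟩ : ∃ a, m a ≠ 0 := by
    by_contra! hall
    have : m = 0 := Finsupp.ext hall
    rw [this, map_zero] at hdeg
    simp at hdeg
    omega
  have h1 := congrArg (MvPolynomial.coeff (m - Finsupp.single a 1)) (h a)
  have h2 : m - Finsupp.single a 1 + Finsupp.single a 1 = m :=
    tsub_add_cancel_of_le (Finsupp.single_le_iff.2 (Nat.one_le_iff_ne_zero.2 ha))
  rw [MvPolynomial.coeff_pderiv, h2, MvPolynomial.coeff_zero] at h1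
  rcases mul_eq_zero.1 h1 with h1 | h1
  · exact hm h1
  · have : (0 : ℝ) ≤ ((m - Finsupp.single a 1 : Fin 4 →₀ ℕ) a : ℕ) := Nat.cast_nonneg _
    linarith

/-- Polynomials in `θ₀, θ₁, θ₂, ω_s` of degree at most `#J` are independent, even after
multiplication with a nonzero form not involving the coordinates in `J`. -/
theorem eq_zero_of_thetaEval_mul_eq_zero (d : ℕ) : ∀ (J : Finset (Fin n)) (T : Forms n)
    (P : MvPolynomial (Fin 4) ℝ), (∀ j ∈ J, ∀ a, coordAnn a j T = 0) → T ≠ 0 → d ≤ J.card →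
    P ∈ HomPoly (d : ℤ) → thetaEval n P * T = 0 → P = 0 := by
  induction d with
  | zero =>
    intro J T P _ hT0 _ hP h
    have hC : P = MvPolynomial.C (P.coeff 0) := by
      ext m
      rw [MvPolynomial.coeff_C]
      split_ifs with hm
      · rw [hm]
      · by_contra h0
        have := hP m h0
        exact hm ((Finsupp.degree_eq_zero_iff m).1 (by exact_mod_cast this)).symm
    rw [hC, ← MvPolynomial.algebraMap_eq, AlgHom.commutes, ← Algebra.smul_def] at h
    rw [hC, (smul_eq_zero.1 h).resolve_right hT0, map_zero]
  | succ d ih =>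
    intro J T P hT hT0 hJ hP h
    obtain ⟨j, hj⟩ : J.Nonempty := card_pos.1 (by omega)
    -- Each partial derivative lowers the degree by one at the cost of one index `j`, whose
    -- covectors are put into `T` through `topForm j`.
    refine eq_zero_of_pderiv_eq_zero hP (by positivity) fun a => ?_
    refine ih (J.erase j) (topForm j * T) _ (fun k hk b => ?_) (fun h0 => hT0 ?_) ?_ ?_ ?_
    · have hkj : ¬ k = j := ne_of_mem_erase hk
      simp [topForm, mul_assoc, coordAnn_coordForm_mul, hkj, hT k (mem_of_mem_erase hk)]
    · have h1 : coordAnn 3 j (coordAnn 2 j (coordAnn 1 j (coordAnn 0 j (topForm j * T)))) = T := by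
        simp [topForm, mul_assoc, coordAnn_coordForm_mul, hT j hj]
      rw [← h1, h0]
      simp
    · rw [card_erase_of_mem hj]; omega
    · have := pderiv_mem_homPoly hP a
      simpa using this
    · rw [← topForm_mul_pairAnn_thetaEval_mul a j P (hT j hj), h, map_zero, mul_zero]

/-! ### Coefficients of homogeneous polynomials and auxiliary linear maps -/

section HomogeneousPolynomials

/-- The exponents of the monomials of degree `d`. -/
def homExponents (d : ℤ) : Finset (Fin 4 →₀ ℕ) :=
  -- For `d < 0` the truncation `d.toNat` is `0`; the filter then discards the exponent `0`.
  (univ.finsuppAntidiag d.toNat).filter fun m => (m.degree : ℤ) = d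

theorem mem_homExponents {d : ℤ} {m : Fin 4 →₀ ℕ} : m ∈ homExponents d ↔ (m.degree : ℤ) = d := by
  rw [homExponents, mem_filter, and_iff_right_iff_imp]
  intro h
  rw [mem_finsuppAntidiag]
  refine ⟨?_, subset_univ _⟩
  rw [← h, Int.toNat_natCast, Finsupp.degree_eq_sum]

/-- The homogeneous polynomial of degree `d` with the given coefficients. -/
def homPolyOfCoeff (d : ℤ) (c : (Fin 4 →₀ ℕ) → ℝ) : MvPolynomial (Fin 4) ℝ :=
  ∑ m ∈ homExponents d, MvPolynomial.monomial m (c m)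

theorem coeff_homPolyOfCoeff (d : ℤ) (c : (Fin 4 →₀ ℕ) → ℝ) (m : Fin 4 →₀ ℕ) :
    (homPolyOfCoeff d c).coeff m = if m ∈ homExponents d then c m else 0 := by
  simp [homPolyOfCoeff, MvPolynomial.coeff_sum, MvPolynomial.coeff_monomial]

theorem homPolyOfCoeff_mem (d : ℤ) (c : (Fin 4 →₀ ℕ) → ℝ) : homPolyOfCoeff d c ∈ HomPoly d :=
  sum_mem fun m hm => monomial_mem_homPoly m _ (mem_homExponents.1 hm)

theorem eq_homPolyOfCoeff {d : ℤ} {P : MvPolynomial (Fin 4) ℝ} (hP : P ∈ HomPoly d)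
    {c : (Fin 4 →₀ ℕ) → ℝ} (hc : ∀ m, P.coeff m = c m) : P = homPolyOfCoeff d c := by
  ext m
  rw [coeff_homPolyOfCoeff]
  split_ifs with h
  · exact hc m
  · by_contra h0
    exact h (mem_homExponents.2 (hP m h0))

theorem homPolyOfCoeff_smul (d : ℤ) (r : ℝ) (c : (Fin 4 →₀ ℕ) → ℝ) :
    homPolyOfCoeff d (fun m => r * c m) = r • homPolyOfCoeff d c := by
  simp [homPolyOfCoeff, smul_sum, MvPolynomial.smul_monomial]

theorem isSmoothCurve_homPolyOfCoeff {d : ℤ} {c : (Fin 4 →₀ ℕ) → ℝ → ℝ}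
    (hc : ∀ m, ContDiffOn ℝ (⊤ : ℕ∞) (c m) (Set.Ici 0)) :
    IsSmoothCurve d fun t => homPolyOfCoeff d fun m => c m t where
  mem := fun t _ => homPolyOfCoeff_mem d _
  smooth := fun m => by
    simp only [coeff_homPolyOfCoeff]
    split_ifs
    · exact hc m
    · exact contDiffOn_const

end HomogeneousPolynomials

/-- A linear map has a linear section on the image of a subspace. -/
theorem exists_linear_section {V W : Type*} [AddCommGroup V] [Module ℝ V] [AddCommGroup W]
    [Module ℝ W] (f : V →ₗ[ℝ] W) (K : Submodule ℝ V) :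
    ∃ s : W →ₗ[ℝ] V, ∀ y ∈ K.map f, s y ∈ K ∧ f (s y) = y := by
  obtain ⟨h, hh⟩ := (f.submoduleMap K).exists_rightInverse_of_surjective
    (LinearMap.range_eq_top.2 (f.submoduleMap_surjective K))
  obtain ⟨s, hs⟩ := (K.subtype ∘ₗ h).exists_extend
  refine ⟨s, fun y hy => ?_⟩
  have h1 : s y = (h ⟨y, hy⟩ : V) := LinearMap.congr_fun hs ⟨y, hy⟩
  have h2 := LinearMap.congr_fun hh ⟨y, hy⟩
  refine ⟨h1 ▸ (h ⟨y, hy⟩).2, ?_⟩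
  rw [h1]
  exact congrArg Subtype.val h2

/-- The unitary group acts transitively on the unit sphere. -/
theorem exists_unitary_map_eq {e v : Cn n} (he : ‖e‖ = 1) (hv : ‖v‖ = 1) :
    ∃ g : Cn n ≃ₗᵢ[ℂ] Cn n, g e = v := by
  let L := (LinearIsometry.toSpanSingleton ℂ (Cn n) hv).comp
    (LinearIsometryEquiv.toSpanUnitSingleton e he).symm.toLinearIsometry
  refine ⟨L.extend.toLinearIsometryEquiv rfl, ?_⟩
  have h1 : (LinearIsometryEquiv.toSpanUnitSingleton (𝕜 := ℂ) e he) 1 =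
      ⟨e, Submodule.mem_span_singleton_self e⟩ := by
    simp [LinearIsometryEquiv.toSpanUnitSingleton]
  have h2 : L ⟨e, Submodule.mem_span_singleton_self e⟩ = v := by
    have h4 := (LinearIsometryEquiv.symm_apply_eq _).2 h1.symm
    change (LinearIsometry.toSpanSingleton ℂ (Cn n) hv)
      ((LinearIsometryEquiv.toSpanUnitSingleton e he).symm ⟨e, _⟩) = v
    rw [h4]
    exact one_smul ℂ v
  have h3 := L.extend_apply ⟨e, Submodule.mem_span_singleton_self e⟩
  rw [h2] at h3
  exact h3

theorem map_neg_id_eq {M : Type*} [AddCommGroup M] [Module ℝ M] (d : ℕ) (x : ExteriorAlgebra ℝ M)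
    (hx : x ∈ LinearMap.range (ι ℝ : M →ₗ[ℝ] ExteriorAlgebra ℝ M) ^ d) :
    ExteriorAlgebra.map (-LinearMap.id) x = (-1 : ℝ) ^ d • x := by
  induction d generalizing x with
  | zero =>
    rw [pow_zero, Submodule.mem_one] at hx
    obtain ⟨r, rfl⟩ := hx
    simp
  | succ d ih =>
    rw [pow_succ'] at hx
    induction hx using Submodule.mul_induction_on' with
    | mem_mul_mem m hm y hy =>
      obtain ⟨m, rfl⟩ := hm
      rw [map_mul, ih y hy, map_apply_ι]
      simp [pow_succ]
    | add x _ y _ hx hy => rw [map_add, hx, hy, smul_add]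

/-! ### Invariant forms along a ray -/

section Invariance

variable {ω : TCn n → Forms n} (hω : IsInvariantForm ω)
include hω

theorem IsInvariantForm.map_diagonal (g : Cn n ≃ₗᵢ[ℂ] Cn n) (z : Cn n) :
    ExteriorAlgebra.map (diagonal g).dualMap (ω (g z, 0)) = ω (z, 0) := by
  have h := congrFun (hω.unitary g) (z, 0)
  rw [pullback, diagonal_apply] at h
  simpa using h

/-- `-1` is unitary, and its pullback acts trivially on forms of the even degree `2 * n`. -/
theorem IsInvariantForm.neg (z : Cn n) : ω (-z, 0) = ω (z, 0) := by
  have h := hω.map_diagonal (LinearIsometryEquiv.neg ℂ) z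
  have h1 : (diagonal (LinearIsometryEquiv.neg ℂ : Cn n ≃ₗᵢ[ℂ] Cn n)).dualMap = -LinearMap.id := by
    refine LinearMap.ext fun m => LinearMap.ext fun p => ?_
    rw [LinearMap.dualMap_apply, diagonal_apply]
    simp only [LinearIsometryEquiv.coe_neg, LinearMap.neg_apply, LinearMap.id_apply]
    rw [← map_neg]
    rfl
  rw [h1, map_neg_id_eq _ _ (hω.degree _), pow_mul] at h
  simpa using h

theorem IsInvariantForm.exists_thetaEval_eq :
    ∃ P ∈ HomPoly (n : ℤ), thetaEval n P = ω (0, 0) := by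
  have h : ω (0, 0) ∈ infInvariant univ := mem_infInvariant_of_map_eq fun g _ => by
    have := hω.map_diagonal g 0
    rwa [map_zero] at this
  exact outerThetaSpan_univ_le (infInvariant_inf_le_outerThetaSpan _ _ ⟨h, hω.degree _⟩)

theorem IsInvariantForm.mem_map_combine (j : Fin n) (r : ℝ) :
    ω (r • EuclideanSpace.single j (1 : ℂ), 0) ∈
      (homTuples n).map (combine (EuclideanSpace.single j (1 : ℂ))) := by
  refine outerThetaSpan_le j (infInvariant_inf_le_outerThetaSpan _ _ ⟨?_, hω.degree _⟩)
  refine mem_infInvariant_of_map_eq fun g hg => ?_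
  have h : g (r • EuclideanSpace.single j (1 : ℂ)) = r • EuclideanSpace.single j (1 : ℂ) := by
    refine hg _ fun u hu => ?_
    have : u j = 0 := hu j (by simp)
    rw [← Complex.coe_smul, inner_smul_right, EuclideanSpace.inner_single_right, this]
    simp
  have := hω.map_diagonal g (r • EuclideanSpace.single j (1 : ℂ))
  rwa [h] at this

/-- Along unit vectors, the difference of an invariant form and its value at the origin is
`ρ ^ 2` times a combination of the generators with smooth coefficients. -/
theorem IsInvariantForm.exists_smooth_coefficients (j : Fin n) :
    ∃ h : Fin 8 → (Fin 4 →₀ ℕ) → ℝ → ℝ,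
      (∀ i m, ContDiffOn ℝ (⊤ : ℕ∞) (h i m) (Set.Ici 0)) ∧
      ∀ (v : Cn n) (ρ : ℝ), ‖v‖ = 1 → ω (ρ • v, 0) = ω (0, 0) +
        ρ ^ 2 • combine v fun i => homPolyOfCoeff (invDeg n i) fun m => h i m (ρ ^ 2) := by
  set e : Cn n := EuclideanSpace.single j (1 : ℂ) with he
  have hne : ‖e‖ = 1 := by simp [he]
  -- `combine e` need not be injective on these tuples: for `n = 1`, `θ₀` equals `γ₁γ₂` at `e`. A
  -- linear choice of coefficients inherits smoothness, evenness and vanishing at `0` from `F`.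
  obtain ⟨s, hs⟩ := exists_linear_section (combine e) (homTuples n)
  let F : ℝ → Forms n := fun r => ω (r • e, 0) - ω (0, 0)
  have hFmem : ∀ r, F r ∈ (homTuples n).map (combine e) := fun r => by
    refine sub_mem (hω.mem_map_combine j r) ?_
    have := hω.mem_map_combine j 0
    rwa [zero_smul] at this
  have hFeven : ∀ r, F (-r) = F r := fun r => by simp only [F, neg_smul, hω.neg]
  have hF0 : F 0 = 0 := by simp [F]
  have hFsmooth : ∀ l : Module.Dual ℝ (Forms n), ContDiff ℝ (⊤ : ℕ∞) fun r => l (F r) := by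
    intro l
    simp only [F, map_sub]
    refine ContDiff.sub ?_ contDiff_const
    exact (hω.smooth l).comp ((contDiff_id.smul contDiff_const).prodMk contDiff_const)
  have key : ∀ (i : Fin 8) (m : Fin 4 →₀ ℕ), ∃ h : ℝ → ℝ, ContDiffOn ℝ (⊤ : ℕ∞) h (Set.Ici 0) ∧
      ∀ r, (s (F r) i).coeff m = r ^ 2 * h (r ^ 2) := by
    intro i m
    refine exists_contDiffOn_eq_sq_mul_of_even (f := fun r => (s (F r) i).coeff m)
      (hFsmooth (MvPolynomial.lcoeff ℝ m ∘ₗ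
        (LinearMap.proj i : (Fin 8 → MvPolynomial (Fin 4) ℝ) →ₗ[ℝ] MvPolynomial (Fin 4) ℝ) ∘ₗ s)) (fun r => ?_) ?_
    · simp only [hFeven]
    · simp [hF0]
  choose h hh hh' using key
  refine ⟨h, hh, fun v ρ hv => ?_⟩
  -- Transport from `e` to `v`. The coefficients depend on `ρ` alone, so they are the same for every
  -- `v`.
  obtain ⟨g, hg⟩ := exists_unitary_map_eq hne hv
  have hg' : g.symm v = e := by rw [← hg, g.symm_apply_apply]
  have h1 : F ρ = ρ ^ 2 • combine e fun i => homPolyOfCoeff (invDeg n i) fun m => h i m (ρ ^ 2) := by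
    obtain ⟨h2, h3⟩ := hs _ (hFmem ρ)
    rw [← h3, ← map_smul]
    congr 1
    funext i
    rw [Pi.smul_apply, ← homPolyOfCoeff_smul]
    exact eq_homPolyOfCoeff (h2 i (Set.mem_univ i)) (hh' i · ρ)
  have h2 := congrArg (ExteriorAlgebra.map (diagonal g.symm).dualMap) h1
  have h3 : g.symm (ρ • v) = ρ • e := by
    rw [← hg', ← Complex.coe_smul, map_smul, Complex.coe_smul]
  have h4 := hω.map_diagonal g.symm (ρ • v)
  have h5 := hω.map_diagonal g.symm 0
  rw [map_zero] at h5
  rw [map_sub, map_smul, ← h3, h4, h5, ← hg', map_diagonal_combine] at h2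
  rw [← h2]
  abel

end Invariance

/-! ### The parallelogram law and the quartic generator -/

theorem norm_smul_single_add {j k : Fin n} (hjk : j ≠ k) {t : ℝ} (ht : t = 1 ∨ t = -1) :
    ‖(√2)⁻¹ • (EuclideanSpace.single j (1 : ℂ) + t • EuclideanSpace.single k (1 : ℂ) : Cn n)‖
      = 1 := by
  have h : ‖(EuclideanSpace.single j (1 : ℂ) + t • EuclideanSpace.single k (1 : ℂ) : Cn n)‖ ^ 2
      = 2 := by
    rw [EuclideanSpace.norm_sq_eq, ← Finset.add_sum_erase _ _ (mem_univ j),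
      ← Finset.add_sum_erase _ _ (mem_erase.2 ⟨hjk.symm, mem_univ k⟩), Finset.sum_eq_zero]
    · rcases ht with rfl | rfl <;> simp [hjk, hjk.symm] <;> norm_num
    · intro i hi
      simp only [mem_erase] at hi
      simp [hi.1, hi.2.1]
  have h2 : ‖(EuclideanSpace.single j (1 : ℂ) + t • EuclideanSpace.single k (1 : ℂ) : Cn n)‖
      = √2 := by
    rw [← h, Real.sqrt_sq (norm_nonneg _)]
  rw [norm_smul, h2, norm_inv, Real.norm_of_nonneg (Real.sqrt_nonneg 2)]
  exact inv_mul_cancel₀ (by positivity)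

theorem deriv_deriv_sq_mul {k : ℝ → ℝ} (hk : ContDiff ℝ (⊤ : ℕ∞) k) :
    deriv (deriv fun r => r ^ 2 * k r) 0 = 2 * k 0 := by
  have hd : Differentiable ℝ k := hk.differentiable (by simp)
  have hd' : Differentiable ℝ (deriv k) :=
    (ContDiff.deriv' (n := (⊤ : ℕ∞)) (by simpa using hk)).differentiable (by simp)
  have h1 : deriv (fun r => r ^ 2 * k r) = fun r => 2 * r * k r + r ^ 2 * deriv k r := by
    funext r
    have := ((hasDerivAt_pow 2 r).fun_mul (hd r).hasDerivAt).deriv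
    simpa using this
  rw [h1]
  have h2 := ((((hasDerivAt_id' (0 : ℝ)).const_mul 2).fun_mul (hd 0).hasDerivAt).fun_add
    ((hasDerivAt_pow 2 (0 : ℝ)).fun_mul (hd' 0).hasDerivAt)).deriv
  simpa using h2

/-- The parallelogram law for second derivatives at the origin. -/
theorem parallelogram_of_sq_mul {E : Type*} [NormedAddCommGroup E]
    [NormedSpace ℝ E] {f : E → ℝ} (hf : ContDiff ℝ (⊤ : ℕ∞) f) 
    {k : E → ℝ → ℝ}
    (hk : ∀ v, ‖v‖ = 1 → ContDiff ℝ (⊤ : ℕ∞) (k v))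
    (hfk : ∀ (v : E) (ρ : ℝ), ‖v‖ = 1 → f (ρ • v) = f 0 + ρ ^ 2 * k v ρ) {v w : E} {s : ℝ}
    (hs : s * s = 1 / 2) (hv : ‖v‖ = 1) (hw : ‖w‖ = 1)
    (hvw : ‖s • (v + (1 : ℝ) • w)‖ = 1) (hvw' : ‖s • (v + (-1 : ℝ) • w)‖ = 1) :
    k (s • (v + (1 : ℝ) • w)) 0 + k (s • (v + (-1 : ℝ) • w)) 0 = k v 0 + k w 0 := by
  have hd : Differentiable ℝ f := hf.differentiable (by simp)
  have hd' : Differentiable ℝ (fderiv ℝ f) :=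
    (hf.fderiv_right (m := (⊤ : ℕ∞)) (by simp)).differentiable (by simp)
  -- Both sides are the second derivative of `f` along `v` at the origin, so `k v 0` is the
  -- restriction of a quadratic form to unit vectors.
  have key : ∀ v, ‖v‖ = 1 → 2 * k v 0 = fderiv ℝ (fderiv ℝ f) 0 v v := by
    intro v hv
    have hlin : ∀ ρ : ℝ, HasDerivAt (fun ρ : ℝ => ρ • v) v ρ := fun ρ => by
      simpa using (hasDerivAt_id ρ).smul_const v
    have h1 : deriv (fun ρ : ℝ => f (ρ • v)) = fun ρ => fderiv ℝ f (ρ • v) v := by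
      funext ρ
      exact ((hd (ρ • v)).hasFDerivAt.comp_hasDerivAt ρ (hlin ρ)).deriv
    have h2 : deriv (fun ρ : ℝ => fderiv ℝ f (ρ • v) v) 0 = fderiv ℝ (fderiv ℝ f) 0 v v := by
      have h3 : HasFDerivAt (fderiv ℝ f) (fderiv ℝ (fderiv ℝ f) ((0 : ℝ) • v)) ((0 : ℝ) • v) :=
        (hd' _).hasFDerivAt
      have h4 := (ContinuousLinearMap.apply ℝ ℝ v).hasFDerivAt.comp_hasDerivAt (0 : ℝ)
        (h3.comp_hasDerivAt (0 : ℝ) (hlin 0))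
      rw [zero_smul] at h4
      exact h4.deriv
    rw [← h2, ← h1, ← deriv_deriv_sq_mul (hk v hv)]
    have h5 : (fun ρ : ℝ => f (ρ • v)) = fun ρ => f 0 + ρ ^ 2 * k v ρ :=
      funext fun ρ => hfk v ρ hv
    rw [h5]
    congr 1
    funext ρ
    rw [deriv_const_add]
  have h1 := key _ hvw
  have h2 := key _ hvw'
  have h3 := key _ hv
  have h4 := key _ hw
  simp only [map_smul, map_add, smul_apply, add_apply,
    smul_eq_mul] at h1 h2
  rw [← sub_eq_zero]
  linear_combination (1 / 2) * h1 + (1 / 2) * h2 - (1 / 2) * h3 - (1 / 2) * h4 +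
    (fderiv ℝ (fderiv ℝ f) 0 v v + fderiv ℝ (fderiv ℝ f) 0 w w) * hs

theorem γ₁_single (j : Fin n) : γ₁ (EuclideanSpace.single j (1 : ℂ)) = coordForm 0 j := by
  rw [γ₁_eq]
  exact (dx_eq j).symm

theorem γ₂_single (j : Fin n) : γ₂ (EuclideanSpace.single j (1 : ℂ)) = coordForm 1 j := by
  rw [γ₂_eq]
  exact (dy_eq j).symm

theorem β₁_single (j : Fin n) : β₁ (EuclideanSpace.single j (1 : ℂ)) = coordForm 2 j := by
  rw [β₁_eq]
  exact (dξ_eq j).symm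

theorem β₂_single (j : Fin n) : β₂ (EuclideanSpace.single j (1 : ℂ)) = coordForm 3 j := by
  rw [β₂_eq]
  exact (dη_eq j).symm

theorem γ₁_smul (r : ℝ) (z : Cn n) : γ₁ (r • z) = r • γ₁ z := by
  simp only [γ₁_eq, map_smul]

theorem γ₂_smul (r : ℝ) (z : Cn n) : γ₂ (r • z) = r • γ₂ z := by
  simp only [γ₂_eq, smul_comm Complex.I r, map_smul]

theorem β₁_smul (r : ℝ) (z : Cn n) : β₁ (r • z) = r • β₁ z := by
  simp only [β₁_eq, map_smul]

theorem β₂_smul (r : ℝ) (z : Cn n) : β₂ (r • z) = r • β₂ z := by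
  simp only [β₂_eq, smul_comm Complex.I r, map_smul]

theorem γ₁_add (z w : Cn n) : γ₁ (z + w) = γ₁ z + γ₁ w := by
  simp only [γ₁_eq, map_add]

theorem γ₂_add (z w : Cn n) : γ₂ (z + w) = γ₂ z + γ₂ w := by
  simp only [γ₂_eq, smul_add, map_add]

theorem β₁_add (z w : Cn n) : β₁ (z + w) = β₁ z + β₁ w := by
  simp only [β₁_eq, map_add]

theorem β₂_add (z w : Cn n) : β₂ (z + w) = β₂ z + β₂ w := by
  simp only [β₂_eq, smul_add, map_add]

/-- All generators but the product `γ₁γ₂β₁β₂` satisfy the parallelogram law. -/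
theorem invGen_parallelogram {i : Fin 8} (hi : i ≠ 0) {s : ℝ} (hs : s * s = 1 / 2)
    {v w : Cn n} : invGen (s • (v + (1 : ℝ) • w)) i + invGen (s • (v + (-1 : ℝ) • w)) i =
      invGen v i + invGen w i := by
  -- Holds for any product of two linear expressions: the mixed terms cancel and `s * s = 1 / 2`
  -- normalizes the rest.
  have key : ∀ a b a' b' : Forms n,
      (s • (a + (1 : ℝ) • a')) * (s • (b + (1 : ℝ) • b')) +
        (s • (a + (-1 : ℝ) • a')) * (s • (b + (-1 : ℝ) • b')) = a * b + a' * b' := by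
    intro a b a' b'
    rw [smul_mul_smul_comm, smul_mul_smul_comm, hs]
    simp only [mul_add, add_mul, smul_mul_assoc, mul_smul_comm]
    module
  fin_cases i
  · exact absurd rfl hi
  all_goals
    simp [invGen, γ₁_smul, γ₂_smul, β₁_smul, β₂_smul, γ₁_add, γ₂_add, β₁_add, β₂_add,
      -one_smul, -neg_smul, -smul_add, -Algebra.smul_mul_assoc,
      -Algebra.mul_smul_comm, key]

section TwoCoordinates

variable (j k : Fin n)

/-- The complementary form used to detect the product `γ₁γ₂β₁β₂`. -/
def detector : Forms n :=
  -- Multiplication by this form kills `γ₁γ₂β₁β₂` at `e_j` and at `e_k`. In its expansion at `s •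
  -- (e_j ± e_k)` only the monomial `dx_j dy_j dξ_k dη_k` survives, with coefficient `s ^ 4 = 1 / 4`
  -- for either sign.
  coordForm 2 j * (coordForm 3 j * (coordForm 0 k * coordForm 1 k))

/-- The form `dx_j ∧ dy_j ∧ dξ_k ∧ dη_k ∧ dξ_j ∧ dη_j ∧ dx_k ∧ dy_k`. -/
def detected : Forms n :=
  coordForm 0 j * (coordForm 1 j * (coordForm 2 k * (coordForm 3 k * detector j k)))

theorem invGen_zero_single_left_mul_detector :
    invGen (EuclideanSpace.single j (1 : ℂ)) 0 * detector j k = 0 := by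
  simp [invGen, γ₁_single, γ₂_single, β₁_single, β₂_single, detector, mul_assoc,
    coordForm_swap_assoc 3 2, coordForm_mul_self_assoc]

theorem coordForm_one_mul_detector :
    coordForm 1 k * (coordForm 2 k * (coordForm 3 k * detector j k)) = 0 := by
  rw [detector, coordForm_swap_assoc 1 2, coordForm_swap_assoc 1 3, coordForm_swap_assoc 1 2,
    coordForm_swap_assoc 1 3, coordForm_swap_assoc 1 0, coordForm_mul_self]
  simp

theorem coordForm_zero_mul_detector :
    coordForm 0 k * (coordForm 1 j * (coordForm 2 k * (coordForm 3 k * detector j k))) = 0 := by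
  rw [detector, coordForm_swap_assoc 0 1, coordForm_swap_assoc 0 2, coordForm_swap_assoc 0 3,
    coordForm_swap_assoc 0 2, coordForm_swap_assoc 0 3, coordForm_mul_self_assoc]
  simp

theorem invGen_zero_single_right_mul_detector :
    invGen (EuclideanSpace.single k (1 : ℂ)) 0 * detector j k = 0 := by
  simp only [invGen, γ₁_single, γ₂_single, β₁_single, β₂_single, mul_assoc,
    Matrix.cons_val_zero, coordForm_one_mul_detector, mul_zero]

theorem invGen_zero_mul_detector {s t : ℝ} (hs : s * s = 1 / 2) (ht : t * t = 1) :
    invGen (s • (EuclideanSpace.single j (1 : ℂ) + t • EuclideanSpace.single k (1 : ℂ))) 0 *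
      detector j k = (1 / 4 : ℝ) • detected j k := by
  have h3 : coordForm 3 j * detector j k = 0 := by
    rw [detector, coordForm_swap_assoc 3 2, coordForm_mul_self_assoc]
    simp
  have h2 : coordForm 2 j * (coordForm 3 k * detector j k) = 0 := by
    rw [detector, coordForm_swap_assoc 2 3, coordForm_mul_self_assoc]
    simp
  have h1 := coordForm_one_mul_detector j k
  have h0 := coordForm_zero_mul_detector j k
  simp only [invGen, γ₁_smul, γ₂_smul, β₁_smul, β₂_smul, γ₁_add, γ₂_add, β₁_add, β₂_add,
    γ₁_single, γ₂_single, β₁_single, β₂_single, mul_assoc, Matrix.cons_val_zero, smul_mul_assoc,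
    mul_smul_comm, add_mul, h0, h1, h2, h3, smul_zero, add_zero, zero_add, smul_smul]
  rw [detected]
  congr 1
  linear_combination (t * t * (s * s + 1 / 2)) * hs + 1 / 4 * ht

variable {j k}

theorem detected_ne_zero (hjk : j ≠ k) : detected j k ≠ 0 := by
  intro h
  have h1 := congrArg (fun x => coordAnn 1 k (coordAnn 0 k (coordAnn 3 j (coordAnn 2 j
    (coordAnn 3 k (coordAnn 2 k (coordAnn 1 j (coordAnn 0 j x)))))))) h
  simp [detected, detector, coordAnn_coordForm_mul, coordAnn_coordForm, hjk, hjk.symm] at h1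

theorem coordAnn_detected {i : Fin n} (hj : i ≠ j) (hk : i ≠ k) (a : Fin 4) :
    coordAnn a i (detected j k) = 0 := by
  simp [detected, detector, coordAnn_coordForm_mul, coordAnn_coordForm, hj, hk]

end TwoCoordinates

/-- The coefficient of `γ₁γ₂β₁β₂` in a family satisfying the parallelogram law vanishes. -/
theorem eq_zero_of_combine_parallelogram {j k : Fin n} (hjk : j ≠ k) {s : ℝ} (hs : s * s = 1 / 2)
    {P : Fin 8 → MvPolynomial (Fin 4) ℝ} (hP : P 0 ∈ HomPoly ((n : ℤ) - 2))
    (h : combine (s • (EuclideanSpace.single j (1 : ℂ) + (1 : ℝ) • EuclideanSpace.single k (1 : ℂ)))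
        P + combine (s • (EuclideanSpace.single j (1 : ℂ) +
          (-1 : ℝ) • EuclideanSpace.single k (1 : ℂ))) P =
      combine (EuclideanSpace.single j (1 : ℂ)) P + combine (EuclideanSpace.single k (1 : ℂ)) P) :
    P 0 = 0 := by
  have h1 : (invGen (s • (EuclideanSpace.single j (1 : ℂ) +
        (1 : ℝ) • EuclideanSpace.single k (1 : ℂ))) 0 +
      invGen (s • (EuclideanSpace.single j (1 : ℂ) +
        (-1 : ℝ) • EuclideanSpace.single k (1 : ℂ))) 0 -
      invGen (EuclideanSpace.single j (1 : ℂ)) 0 - invGen (EuclideanSpace.single k (1 : ℂ)) 0) *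
        thetaEval n (P 0) = 0 := by
    simp only [combine_apply, ← sum_add_distrib, ← add_mul] at h
    rw [← sub_eq_zero, ← sum_sub_distrib, sum_eq_single 0] at h
    · rw [← h]
      noncomm_ring
    · intro i _ hi
      rw [invGen_parallelogram hi hs, sub_self]
    · simp
  have h2 := congrArg (· * detector j k) h1
  simp only [zero_mul] at h2
  rw [mul_assoc, ← thetaEval_mul_comm, ← mul_assoc, sub_mul _ _ (detector j k),
    sub_mul _ _ (detector j k), add_mul _ _ (detector j k),
    invGen_zero_mul_detector j k hs (by norm_num), invGen_zero_mul_detector j k hs (by norm_num),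
    invGen_zero_single_left_mul_detector, invGen_zero_single_right_mul_detector, sub_zero,
    sub_zero, ← add_smul, thetaEval_mul_comm] at h2
  have hcard : (({j, k} : Finset (Fin n))ᶜ).card = n - 2 := by
    rw [card_compl, card_pair hjk, Fintype.card_fin]
  have hn : 2 ≤ n := by
    have := card_le_univ ({j, k} : Finset (Fin n))
    rwa [card_pair hjk, Fintype.card_fin] at this
  -- `detected j k` uses up two coordinates; the `n - 2` others are just enough for the degree of `P
  -- 0`.
  refine eq_zero_of_thetaEval_mul_eq_zero (n - 2) ({j, k} : Finset (Fin n))ᶜ (detected j k) _ ?_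
    (detected_ne_zero hjk) hcard.ge ?_ ?_
  · intro i hi a
    simp only [mem_compl, mem_insert, mem_singleton, not_or] at hi
    exact coordAnn_detected hi.1 hi.2 a
  · rwa [Nat.cast_sub hn]
  · rw [mul_smul_comm] at h2
    exact (smul_eq_zero.1 h2).resolve_left (by norm_num)

/-- The coefficient of `γ₁γ₂β₁β₂` vanishes at the origin. -/
theorem IsInvariantForm.coefficient_zero_eq_zero {ω : TCn n → Forms n} (hω : IsInvariantForm ω)
    (j : Fin n) {h : Fin 8 → (Fin 4 →₀ ℕ) → ℝ → ℝ}
    (hh : ∀ i m, ContDiffOn ℝ (⊤ : ℕ∞) (h i m) (Set.Ici 0))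
    (hv : ∀ (v : Cn n) (ρ : ℝ), ‖v‖ = 1 → ω (ρ • v, 0) = ω (0, 0) +
      ρ ^ 2 • combine v fun i => homPolyOfCoeff (invDeg n i) fun m => h i m (ρ ^ 2)) :
    homPolyOfCoeff ((n : ℤ) - 2) (fun m => h 0 m 0) = 0 := by
  by_cases hn : ∃ k, j ≠ k
  · obtain ⟨k, hjk⟩ := hn
    have hs : (√2)⁻¹ * (√2)⁻¹ = (1 / 2 : ℝ) := by
      rw [← mul_inv, Real.mul_self_sqrt zero_le_two, one_div]
    refine eq_zero_of_combine_parallelogram hjk hs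
      (P := fun i => homPolyOfCoeff (invDeg n i) fun m => h i m 0) (homPolyOfCoeff_mem _ _) ?_
    rw [← sub_eq_zero]
    refine (Module.forall_dual_apply_eq_zero_iff ℝ _).1 fun l => ?_
    have key := parallelogram_of_sq_mul (f := fun z : Cn n => l (ω (z, 0)))
      ((hω.smooth l).comp (contDiff_id.prodMk contDiff_const))
      (k := fun v ρ => l (combine v fun i => homPolyOfCoeff (invDeg n i) fun m => h i m (ρ ^ 2)))
      (fun v _ => ?_) (fun v ρ h1 => by simp only [hv v ρ h1, map_add, map_smul, smul_eq_mul]) hs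
      (v := EuclideanSpace.single j (1 : ℂ)) (w := EuclideanSpace.single k (1 : ℂ)) (by simp)
      (by simp) (norm_smul_single_add hjk (Or.inl rfl)) (norm_smul_single_add hjk (Or.inr rfl))
    · rw [map_sub, map_add, map_add, sub_eq_zero]
      simpa only [ne_eq, OfNat.ofNat_ne_zero, not_false_eq_true, zero_pow] using key
    · have h1 : ∀ (i : Fin 8) (m : Fin 4 →₀ ℕ), ContDiff ℝ (⊤ : ℕ∞) fun ρ : ℝ => h i m (ρ ^ 2) :=
        fun i m => contDiffOn_univ.1
          ((hh i m).comp (contDiff_id.pow 2).contDiffOn fun ρ _ => sq_nonneg ρ)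
      have h2 : ∀ (i : Fin 8) (m : Fin 4 →₀ ℕ) (c : ℝ),
          l (invGen v i * thetaEval n (MvPolynomial.monomial m c)) =
            c * l (invGen v i * thetaEval n (MvPolynomial.monomial m 1)) := by
        intro i m c
        rw [← smul_eq_mul c (l _), ← map_smul l, ← mul_smul_comm, ← map_smul (thetaEval n), MvPolynomial.smul_monomial,
          smul_eq_mul, mul_one]
      simp only [combine_apply, homPolyOfCoeff, map_sum, mul_sum]
      exact ContDiff.sum fun i _ => ContDiff.sum fun m _ => by
        simpa only [h2 i m (h i m _)] using (h1 i m).mul contDiff_const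
  -- With a single coordinate the degree `n - 2` is negative and the polynomial is zero anyway.
  · push Not at hn
    have h1 : n = 1 := by
      have := Fintype.card_eq_one_iff.2 ⟨j, fun k => (hn k).symm⟩
      rwa [Fintype.card_fin] at this
    subst h1
    ext m
    rw [coeff_homPolyOfCoeff, if_neg, MvPolynomial.coeff_zero]
    rw [mem_homExponents]
    omega

/-! ### Assembling the coefficients -/

/-- An invariant form is a combination of the generators with smooth coefficients. -/
theorem IsInvariantForm.exists_isSmoothCurve {ω : TCn n → Forms n} (hω : IsInvariantForm ω) :
    ∃ R : Fin 8 → ℝ → MvPolynomial (Fin 4) ℝ, (∀ i, IsSmoothCurve (invDeg n i) (R i)) ∧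
      ∀ z ζ, ω (z, ζ) = combine z fun i => R i (‖z‖ ^ 2) := by
  obtain ⟨P, hP, hPω⟩ := hω.exists_thetaEval_eq
  -- For `n = 0` there are no unit vectors and the origin is the only point, so its value is the
  -- whole answer.
  rcases isEmpty_or_nonempty (Fin n) with hn | ⟨⟨j⟩⟩
  · refine ⟨Pi.single 7 fun _ => P, fun i => ?_, fun z ζ => ?_⟩
    · by_cases hi : i = 7
      · subst hi
        rw [Pi.single_eq_same]
        exact ⟨fun _ _ => hP, fun _ => contDiffOn_const⟩
      · rw [Pi.single_eq_of_ne hi]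
        exact ⟨fun _ _ => zero_mem _, fun _ => contDiffOn_const⟩
    · have h1 : (fun i => (Pi.single 7 (fun _ => P) : Fin 8 → ℝ → MvPolynomial (Fin 4) ℝ) i
          (‖z‖ ^ 2)) = Pi.single 7 P := by
        funext i
        by_cases hi : i = 7
        · subst hi
          simp
        · simp [hi]
      rw [h1, combine_single, Subsingleton.elim z 0, hω.translation 0 ζ 0, ← hPω]
      exact (one_mul _).symm
  obtain ⟨h, hh, hv⟩ := hω.exists_smooth_coefficients j
  have h0 := hω.coefficient_zero_eq_zero j hh hv
  -- The coefficient of `γ₁γ₂β₁β₂` vanishes at `0`; this extracts the second factor `ρ ^ 2` that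
  -- this generator needs.
  have hk : ∀ m : Fin 4 →₀ ℕ, ∃ k : ℝ → ℝ, ContDiffOn ℝ (⊤ : ℕ∞) k (Set.Ici 0) ∧
      (m ∈ homExponents ((n : ℤ) - 2) → ∀ r : ℝ, h 0 m (r ^ 2) = r ^ 2 * k (r ^ 2)) := by
    intro m
    by_cases hm : m ∈ homExponents ((n : ℤ) - 2)
    · have h1 := congrArg (MvPolynomial.coeff m) h0
      rw [coeff_homPolyOfCoeff, if_pos hm, MvPolynomial.coeff_zero] at h1
      obtain ⟨k, hk, hk'⟩ := exists_contDiffOn_eq_sq_mul_of_even (f := fun r => h 0 m (r ^ 2))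
        (contDiffOn_univ.1 ((hh 0 m).comp (contDiff_id.pow 2).contDiffOn fun ρ _ => sq_nonneg ρ))
        (fun r => by rw [neg_sq]) (by simpa using h1)
      exact ⟨k, hk, fun _ => hk'⟩
    · exact ⟨0, contDiffOn_const, fun h => absurd h hm⟩
  choose k hk hk' using hk
  have hα : ∀ r : ℝ, homPolyOfCoeff ((n : ℤ) - 2) (fun m => h 0 m (r ^ 2)) =
      r ^ 2 • homPolyOfCoeff ((n : ℤ) - 2) (fun m => k m (r ^ 2)) := by
    intro r
    rw [← homPolyOfCoeff_smul]
    exact sum_congr rfl fun m hm => congrArg _ (hk' m hm r)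
  let H : Fin 8 → ℝ → MvPolynomial (Fin 4) ℝ := fun i t =>
    homPolyOfCoeff (invDeg n i) fun m => h i m t
  have hH : ∀ i, IsSmoothCurve (invDeg n i) (H i) := fun i => isSmoothCurve_homPolyOfCoeff (hh i)
  refine ⟨![fun t => homPolyOfCoeff ((n : ℤ) - 2) fun m => k m t, H 1, H 2, H 3, H 4, H 5, H 6,
    fun t => P + t • H 7 t], fun i => ?_, fun z ζ => ?_⟩
  · fin_cases i
    · exact isSmoothCurve_homPolyOfCoeff hk
    · exact hH 1
    · exact hH 2
    · exact hH 3
    · exact hH 4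
    · exact hH 5
    · exact hH 6
    · refine ⟨fun t ht => add_mem hP (Submodule.smul_mem _ _ ((hH 7).mem t ht)), fun m => ?_⟩
      exact contDiffOn_const.add (contDiffOn_id.mul ((hH 7).smooth m))
  -- At `z = 0` any unit vector serves.
  · obtain ⟨v, hv1, hz⟩ : ∃ v : Cn n, ‖v‖ = 1 ∧ z = ‖z‖ • v := by
      by_cases hz : z = 0
      · exact ⟨EuclideanSpace.single j 1, by simp, by simp [hz]⟩
      · refine ⟨‖z‖⁻¹ • z, ?_, ?_⟩
        · rw [norm_smul, norm_inv, norm_norm, inv_mul_cancel₀ (norm_ne_zero_iff.2 hz)]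
        · rw [smul_smul, mul_inv_cancel₀ (norm_ne_zero_iff.2 hz), one_smul]
    generalize ‖z‖ = ρ at hz
    subst hz
    have h7 := hv v ρ hv1
    rw [hω.translation _ ζ 0, h7, ← hPω]
    simp only [combine_apply, Fin.sum_univ_eight]
    have e0 : invDeg n 0 = (n : ℤ) - 2 := rfl
    -- Homogeneity in `z = ρ • v`: the quadratic generators absorb `ρ ^ 2`, the quartic one `ρ ^ 4`,
    -- and the constant one keeps its factor as `t • H 7 t`.
    simp only [e0, hα, invGen, γ₁_smul, γ₂_smul, β₁_smul, β₂_smul, smul_mul_assoc, mul_smul_comm,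
      map_add, map_smul, smul_add, smul_smul, H, Matrix.cons_val, mul_add, one_mul]
    module

end UnitaryForms

end

theorem theorem3p9 (n : ℕ) (ω : UnitaryForms.TCn n → UnitaryForms.Forms n)
    (hω : UnitaryForms.IsInvariantForm ω) :
    ∃ Rα Rγ₁γ₂ Rγ₁β₁ Rγ₁β₂ Rγ₂β₁ Rγ₂β₂ Rβ₁β₂ Rδ : ℝ → MvPolynomial (Fin 4) ℝ,
      UnitaryForms.IsSmoothCurve ((n : ℤ) - 2) Rα ∧
      UnitaryForms.IsSmoothCurve ((n : ℤ) - 1) Rγ₁γ₂ ∧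
      UnitaryForms.IsSmoothCurve ((n : ℤ) - 1) Rγ₁β₁ ∧
      UnitaryForms.IsSmoothCurve ((n : ℤ) - 1) Rγ₁β₂ ∧
      UnitaryForms.IsSmoothCurve ((n : ℤ) - 1) Rγ₂β₁ ∧
      UnitaryForms.IsSmoothCurve ((n : ℤ) - 1) Rγ₂β₂ ∧
      UnitaryForms.IsSmoothCurve ((n : ℤ) - 1) Rβ₁β₂ ∧
      UnitaryForms.IsSmoothCurve (n : ℤ) Rδ ∧
      ∀ z ζ : UnitaryForms.Cn n,
        ω (z, ζ) =
          UnitaryForms.γ₁ z * UnitaryForms.γ₂ z * UnitaryForms.β₁ z * UnitaryForms.β₂ z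
              * UnitaryForms.evalForms n (Rα (‖z‖ ^ 2))
            + UnitaryForms.γ₁ z * UnitaryForms.γ₂ z * UnitaryForms.evalForms n (Rγ₁γ₂ (‖z‖ ^ 2))
            + UnitaryForms.γ₁ z * UnitaryForms.β₁ z * UnitaryForms.evalForms n (Rγ₁β₁ (‖z‖ ^ 2))
            + UnitaryForms.γ₁ z * UnitaryForms.β₂ z * UnitaryForms.evalForms n (Rγ₁β₂ (‖z‖ ^ 2))
            + UnitaryForms.γ₂ z * UnitaryForms.β₁ z * UnitaryForms.evalForms n (Rγ₂β₁ (‖z‖ ^ 2))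
            + UnitaryForms.γ₂ z * UnitaryForms.β₂ z * UnitaryForms.evalForms n (Rγ₂β₂ (‖z‖ ^ 2))
            + UnitaryForms.β₁ z * UnitaryForms.β₂ z * UnitaryForms.evalForms n (Rβ₁β₂ (‖z‖ ^ 2))
            + UnitaryForms.evalForms n (Rδ (‖z‖ ^ 2)) := by
  obtain ⟨R, hR, hω'⟩ := hω.exists_isSmoothCurve
  refine ⟨R 0, R 1, R 2, R 3, R 4, R 5, R 6, R 7, hR 0, hR 1, hR 2, hR 3, hR 4, hR 5, hR 6, hR 7,
    fun z ζ => ?_⟩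
  simp only [UnitaryForms.evalForms_eq]
  rw [hω', UnitaryForms.combine_apply, Fin.sum_univ_eight]
  simp only [UnitaryForms.invGen, Matrix.cons_val, one_mul]
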